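/- Let $m$ be the normalized Lebesgue measure on the unit circle $\mathbb{T}$, write $|I|=m(I)$ for a subarc $I\subset\mathbb{T}$, and let $w:\mathbb{T}\to[0,\infty]$ be a measurable function (a scalar weight; e.g. any nonnegative $w\in L^1(\mathbb{T})$). Put $w^{-1}=1/w$, with $1/0=\infty$ and $1/\infty=0$, and in products use $0\cdot\infty=0$. For measurable $f:\mathbb{T}\to[0,\infty]$ and $\lambda\in\mathbb{D}$ let $$f(\lambda)=\int_{\mathbb{T}}\frac{1-|\lambda|^2}{|z-\lambda|^2}\,f(z)\,dm(z)\in[0,\infty]$$ be its harmonic (Poisson) extension. A real function $\varphi\in L^1(\mathbb{T})$ belongs to $\mathrm{VMO}$ if its mean oscillations $\frac1{|I|}\int_I|\varphi-\varphi_I|\,dm$, where $\varphi_I=\frac1{|I|}\int_I\varphi\,dm$, are bounded over all subarcs $I\subset\mathbb{T}$ of positive length and tend to $0$ as $|I|\to0$, uniformly in the position of $I$. The following are equivalent: 1. $\displaystyle\limsup_{|I|\to0}\Bigl(\frac1{|I|}\int_I w\,dm\Bigr)\Bigl(\frac1{|I|}\int_I w^{-1}\,dm\Bigr)=1$, where $I$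 runs over the subarcs of $\mathbb{T}$; 2. $\displaystyle\limsup_{|\lambda|\to1^-} w(\lambda)\,w^{-1}(\lambda)=1$, where $w(\lambda)$ and $w^{-1}(\lambda)$ are the harmonic extensions of $w$ and of $w^{-1}$ at $\lambda\in\mathbb{D}$; 3. $w=e^{\varphi}$ almost everywhere on $\mathbb{T}$ for some real-valued $\varphi\in\mathrm{VMO}$. -/

import Mathlib

open MeasureTheory Filter Topology
open scoped ENNReal

/-! The unit circle `𝕋` is modelled by `UnitAddCircle = ℝ ⧸ ℤ` through the parametrization
`θ ↦ exp (2 π i θ)` (`AddCircle.toCircle`).  Its `volume` is the normalized Lebesgue measure `m`,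
with `m(𝕋) = 1`. -/

/-- The closed subarc of the circle with centre `c` and (normalized) length `ℓ`, for `0 < ℓ ≤ 1`. -/
def arc (c : UnitAddCircle) (ℓ : ℝ) : Set UnitAddCircle :=
  Metric.closedBall c (ℓ / 2)

theorem volume_arc (c : UnitAddCircle) {ℓ : ℝ} (hℓ : ℓ ≤ 1) :
    volume (arc c ℓ) = ENNReal.ofReal ℓ := by
  rw [arc, AddCircle.volume_closedBall, mul_div_cancel₀ _ (two_ne_zero), min_eq_right hℓ]

/-- The filter `|I| → 0` on the arcs `I`, encoded by pairs (centre, length):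
the length tends to `0` from the right and the centre is unrestricted. -/
def arcsShrinking : Filter (UnitAddCircle × ℝ) :=
  (⊤ : Filter UnitAddCircle) ×ˢ 𝓝[>] (0 : ℝ)

/-- The filter `|lam| → 1` on the points `lam` of the open unit disk. -/
noncomputable def toBoundary : Filter ℂ :=
  comap (fun lam : ℂ => ‖lam‖) (𝓝[<] (1 : ℝ))

/-- The average `f_I = |I|⁻¹ ∫_I f dm` of a `[0, ∞]`-valued function over the arc `I`
with centre `c` and length `ℓ`. -/
noncomputable def arcAverage (f : UnitAddCircle → ℝ≥0∞) (c : UnitAddCircle) (ℓ : ℝ) : ℝ≥0∞ :=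
  ⨍⁻ θ, f θ ∂(volume.restrict (arc c ℓ))

/-- The harmonic (Poisson) extension of a `[0, ∞]`-valued function at a point `lam` of the disk,
`∫ (1 - |lam|²) / |z - lam|² f(z) dm(z)`. -/
noncomputable def harmonicExtension (f : UnitAddCircle → ℝ≥0∞) (lam : ℂ) : ℝ≥0∞ :=
  ∫⁻ θ : UnitAddCircle,
    ENNReal.ofReal (poissonKernel 0 lam (AddCircle.toCircle θ : ℂ)) * f θ

/-- The mean oscillation `|I|⁻¹ ∫_I |f - f_I| dm` over the arc with centre `c` and length `ℓ`. -/
noncomputable def meanOscillation (f : UnitAddCircle → ℝ) (c : UnitAddCircle) (ℓ : ℝ) : ℝ :=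
  ⨍ θ in arc c ℓ, |f θ - ⨍ η in arc c ℓ, f η|

/-- Real functions of bounded mean oscillation on the circle. -/
def IsBMO (f : UnitAddCircle → ℝ) : Prop :=
  Integrable f ∧ ∃ C : ℝ, ∀ c : UnitAddCircle, ∀ ℓ ∈ Set.Ioc (0 : ℝ) 1, meanOscillation f c ℓ ≤ C

/-- Real functions of vanishing mean oscillation on the circle: `f ∈ BMO` and the mean oscillation
over `I` tends to `0`, uniformly in the position of `I`, as `|I| → 0`. -/
def IsVMO (f : UnitAddCircle → ℝ) : Prop :=
  IsBMO f ∧ Tendsto (fun I : UnitAddCircle × ℝ => meanOscillation f I.1 I.2) arcsShrinking (𝓝 0)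

/-!
Averages over arcs and Poisson extensions are both integrals against probability measures on the
circle, `arcMeasure c ℓ` and `poissonMeasure lam`, so one argument serves both. For a probability
measure `μ` and `w = exp φ`, the Cauchy–Schwarz inequality gives `1 ≤ (∫ w dμ) (∫ w⁻¹ dμ)`, so each
limit superior is `1` exactly when the product is eventually at most `1 + ε` for every `ε > 0`.

*From small products to `VMO`.* If the product is at most `1 + ε`, choose `a` such that
`exp (φ - a)` and `exp (-(φ - a))` have the same mean. As `exp x + exp (-x) - 2 ≥ x ^ 2 / 2`, the
mean of `(φ - a) ^ 2` is at most `2 ε` (`exists_lintegral_sq_sub_le`). Such a bound on all short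
arcs is enough for `VMO` (`isVMO_of_lintegral_sq_sub_le`). In the case of Poisson means, an arc of
length `ℓ` is compared with the point of modulus `1 - ℓ` over its centre
(`arcMeasure_le_poissonMeasure`). Weights that vanish or are infinite on a set of positive measure
are excluded because a product of means would be infinite, or, if `w` is almost everywhere `0` or
almost everywhere `∞`, because all products are `0`. For arcs this uses the connectedness of the
circle (`ae_trichotomy_of_arcs`).

*From `VMO` to small products.* It suffices to find `a` for which the mean of `exp |φ - a|` is close
to `1` (`lintegral_exp_mul_lintegral_exp_neg_le`). On short arcs, with `a` the average of `φ`, this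
is a form of the John–Nirenberg inequality (`lintegral_exp_sub_average_le`). It is proved by
induction on the generation of dyadic approximations of `φ`, with a bound that is linear in the mean
of `|φ - a|` and so is preserved under halving an arc (`lintegral_exp_dyadicApprox_le`). The Poisson
measure is dominated by a combination, with geometrically decaying weights, of averages over
concentric arcs of dyadic lengths (`setLIntegral_poissonKernel_le`). The averages of `φ` over these
arcs grow at most linearly in the number of doublings, with a small constant, so the sum is small
(`lintegral_exp_poissonMeasure_le`).
-/

/-! ### Normalized measures on arcs -/

/-- The normalized Lebesgue measure on the arc with centre `c` and length `ℓ`. -/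
noncomputable def arcMeasure (c : UnitAddCircle) (ℓ : ℝ) : Measure UnitAddCircle :=
  ((volume.restrict (arc c ℓ)) Set.univ)⁻¹ • volume.restrict (arc c ℓ)

theorem arcAverage_eq (f : UnitAddCircle → ℝ≥0∞) (c : UnitAddCircle) (ℓ : ℝ) :
    arcAverage f c ℓ = ∫⁻ θ, f θ ∂arcMeasure c ℓ := rfl

theorem meanOscillation_eq (f : UnitAddCircle → ℝ) (c : UnitAddCircle) (ℓ : ℝ) :
    meanOscillation f c ℓ = ∫ θ, |f θ - ∫ η, f η ∂arcMeasure c ℓ| ∂arcMeasure c ℓ := rfl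

theorem measurableSet_arc (c : UnitAddCircle) (ℓ : ℝ) : MeasurableSet (arc c ℓ) :=
  measurableSet_closedBall

theorem arcMeasure_eq (c : UnitAddCircle) {ℓ : ℝ} (hℓ : ℓ ≤ 1) :
    arcMeasure c ℓ = (ENNReal.ofReal ℓ)⁻¹ • volume.restrict (arc c ℓ) := by
  rw [arcMeasure, Measure.restrict_apply_univ, volume_arc c hℓ]

theorem isProbabilityMeasure_arcMeasure (c : UnitAddCircle) {ℓ : ℝ} (h0 : 0 < ℓ) (h1 : ℓ ≤ 1) :
    IsProbabilityMeasure (arcMeasure c ℓ) := by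
  refine ⟨?_⟩
  rw [arcMeasure_eq c h1, Measure.smul_apply, Measure.restrict_apply_univ, volume_arc c h1,
    smul_eq_mul, ENNReal.inv_mul_cancel (by simpa using h0) ENNReal.ofReal_ne_top]

theorem arcMeasure_le (c : UnitAddCircle) {ℓ : ℝ} (h1 : ℓ ≤ 1) :
    arcMeasure c ℓ ≤ (ENNReal.ofReal ℓ)⁻¹ • volume := by
  rw [arcMeasure_eq c h1]
  gcongr
  exact Measure.restrict_le_self

theorem arcMeasure_absolutelyContinuous (c : UnitAddCircle) {ℓ : ℝ} (h1 : ℓ ≤ 1) :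
    arcMeasure c ℓ ≪ volume :=
  (Measure.absolutelyContinuous_of_le (arcMeasure_le c h1)).trans
    (Measure.smul_absolutelyContinuous)

theorem restrict_arc_eq_smul (c : UnitAddCircle) {ℓ : ℝ} (h0 : 0 < ℓ) (h1 : ℓ ≤ 1) :
    volume.restrict (arc c ℓ) = ENNReal.ofReal ℓ • arcMeasure c ℓ := by
  rw [arcMeasure_eq c h1, smul_smul, ENNReal.mul_inv_cancel (by simpa using h0)
    ENNReal.ofReal_ne_top, one_smul]

theorem integrable_arcMeasure {f : UnitAddCircle → ℝ} (hf : Integrable f)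
    (c : UnitAddCircle) {ℓ : ℝ} (h0 : 0 < ℓ) (h1 : ℓ ≤ 1) : Integrable f (arcMeasure c ℓ) :=
  (hf.smul_measure (c := (ENNReal.ofReal ℓ)⁻¹) (by simpa using h0)).mono_measure
    (arcMeasure_le c h1)

/-- The representative `y ∈ [-1/2, 1/2]` of a point of the circle realizes its norm. -/
theorem exists_real_rep (x : UnitAddCircle) : ∃ y : ℝ, (y : UnitAddCircle) = x ∧ |y| = ‖x‖ := by
  obtain ⟨z, rfl⟩ := QuotientAddGroup.mk_surjective x
  refine ⟨z - round z, ?_, (UnitAddCircle.norm_eq).symm⟩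
  have : (((round z : ℤ) : ℝ) : UnitAddCircle) = 0 :=
    (AddCircle.coe_eq_zero_iff _).2 ⟨round z, by simp⟩
  rw [AddCircle.coe_sub, this, sub_zero]

theorem arc_eq_union_halves (c : UnitAddCircle) (ℓ : ℝ) :
    arc c ℓ = arc (c - ((ℓ / 4 : ℝ) : UnitAddCircle)) (ℓ / 2) ∪
      arc (c + ((ℓ / 4 : ℝ) : UnitAddCircle)) (ℓ / 2) := by
  have hnorm : ∀ y : ℝ, ‖(y : UnitAddCircle)‖ ≤ |y| := fun y => by
    rw [UnitAddCircle.norm_eq]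
    simpa using round_le y 0
  ext x
  simp only [arc, Set.mem_union, Metric.mem_closedBall, dist_eq_norm]
  constructor
  · intro h
    obtain ⟨y, hy1, hy2⟩ := exists_real_rep (x - c)
    rw [← hy2] at h
    have hx : x = c + y := by rw [hy1]; abel
    rcases le_total 0 y with h0 | h0
    · right
      rw [abs_of_nonneg h0] at h
      rw [show x - (c + ((ℓ / 4 : ℝ) : UnitAddCircle)) = ((y - ℓ / 4 : ℝ) : UnitAddCircle) by
        rw [hx, AddCircle.coe_sub]; abel]
      refine (hnorm _).trans (abs_le.2 ⟨?_, ?_⟩) <;> linarith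
    · left
      rw [abs_of_nonpos h0] at h
      rw [show x - (c - ((ℓ / 4 : ℝ) : UnitAddCircle)) = ((y + ℓ / 4 : ℝ) : UnitAddCircle) by
        rw [hx, AddCircle.coe_add]; abel]
      refine (hnorm _).trans (abs_le.2 ⟨?_, ?_⟩) <;> linarith
  · rintro (h | h)
    · have h0 : 0 ≤ ℓ := by linarith [norm_nonneg (x - (c - ((ℓ / 4 : ℝ) : UnitAddCircle)))]
      have := hnorm (ℓ / 4)
      rw [abs_of_nonneg (by linarith)] at this
      calc ‖x - c‖
          = ‖(x - (c - ((ℓ / 4 : ℝ) : UnitAddCircle))) - ((ℓ / 4 : ℝ) : UnitAddCircle)‖ := by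
            congr 1; abel
        _ ≤ _ := norm_sub_le _ _
        _ ≤ ℓ / 2 := by linarith
    · have h0 : 0 ≤ ℓ := by linarith [norm_nonneg (x - (c + ((ℓ / 4 : ℝ) : UnitAddCircle)))]
      have := hnorm (ℓ / 4)
      rw [abs_of_nonneg (by linarith)] at this
      calc ‖x - c‖
          = ‖(x - (c + ((ℓ / 4 : ℝ) : UnitAddCircle))) + ((ℓ / 4 : ℝ) : UnitAddCircle)‖ := by
            congr 1; abel
        _ ≤ _ := norm_add_le _ _
        _ ≤ ℓ / 2 := by linarith

/-- The measures of the two halves add up to that of the arc, so their overlap is a null set. -/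
theorem aedisjoint_halves (c : UnitAddCircle) {ℓ : ℝ} (h0 : 0 < ℓ) (h1 : ℓ ≤ 1) :
    AEDisjoint volume (arc (c - ((ℓ / 4 : ℝ) : UnitAddCircle)) (ℓ / 2))
      (arc (c + ((ℓ / 4 : ℝ) : UnitAddCircle)) (ℓ / 2)) := by
  have h := measure_union_add_inter (μ := volume) (arc (c - ((ℓ / 4 : ℝ) : UnitAddCircle)) (ℓ / 2))
    (measurableSet_arc (c + ((ℓ / 4 : ℝ) : UnitAddCircle)) (ℓ / 2))
  rw [← arc_eq_union_halves, volume_arc _ h1, volume_arc _ (by linarith),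
    volume_arc _ (by linarith),
    ← ENNReal.ofReal_add (by linarith) (by linarith), add_halves] at h
  nth_rewrite 2 [← add_zero (ENNReal.ofReal ℓ)] at h
  exact (ENNReal.add_right_inj ENNReal.ofReal_ne_top).1 h

theorem arcMeasure_eq_halves (c : UnitAddCircle) {ℓ : ℝ} (h0 : 0 < ℓ) (h1 : ℓ ≤ 1) :
    arcMeasure c ℓ = (2 : ℝ≥0∞)⁻¹ • (arcMeasure (c - ((ℓ / 4 : ℝ) : UnitAddCircle)) (ℓ / 2) +
      arcMeasure (c + ((ℓ / 4 : ℝ) : UnitAddCircle)) (ℓ / 2)) := by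
  rw [arcMeasure_eq c h1, arcMeasure_eq _ (by linarith), arcMeasure_eq _ (by linarith),
    arc_eq_union_halves, Measure.restrict_union₀ (aedisjoint_halves c h0 h1)
      (measurableSet_arc _ _).nullMeasurableSet, ← smul_add, smul_smul]
  congr 1
  rw [← ENNReal.mul_inv (by simp) (by simp), ← ENNReal.ofReal_ofNat, ← ENNReal.ofReal_mul (by simp)]
  congr 2
  ring

/-- Averages over the halved concentric arc are at most twice the averages over the arc. -/
theorem arcMeasure_half_le (c : UnitAddCircle) {ℓ : ℝ} (h0 : 0 < ℓ) (h1 : ℓ ≤ 1) :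
    arcMeasure c (ℓ / 2) ≤ (2 : ℝ≥0∞) • arcMeasure c ℓ := by
  rw [arcMeasure_eq c h1, arcMeasure_eq c (by linarith), smul_smul]
  have : (ENNReal.ofReal (ℓ / 2))⁻¹ = 2 * (ENNReal.ofReal ℓ)⁻¹ := by
    rw [ENNReal.ofReal_div_of_pos two_pos, ENNReal.ofReal_ofNat,
      ENNReal.inv_div (by simp) (by simp),
      div_eq_mul_inv]
  rw [this]
  gcongr
  exact Metric.closedBall_subset_closedBall (by linarith)

/-! ### A John–Nirenberg inequality for small oscillation -/

open scoped Classical in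
/-- The dyadic approximation of generation `n` to `f` on the arc with centre `c` and length `ℓ`: at
`x` it is the average of `f` over the arc containing `x` among those obtained from the given one by
`n` successive halvings.  Where two of these arcs meet the first one is taken. -/
noncomputable def dyadicApprox (f : UnitAddCircle → ℝ) :
    ℕ → UnitAddCircle → ℝ → UnitAddCircle → ℝ
  | 0, c, ℓ, _ => ∫ θ, f θ ∂arcMeasure c ℓ
  | n + 1, c, ℓ, x =>
    if x ∈ arc (c - ((ℓ / 4 : ℝ) : UnitAddCircle)) (ℓ / 2) then
      dyadicApprox f n (c - ((ℓ / 4 : ℝ) : UnitAddCircle)) (ℓ / 2) x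
    else dyadicApprox f n (c + ((ℓ / 4 : ℝ) : UnitAddCircle)) (ℓ / 2) x

theorem measurable_dyadicApprox (f : UnitAddCircle → ℝ) (n : ℕ) (c : UnitAddCircle) (ℓ : ℝ) :
    Measurable (dyadicApprox f n c ℓ) := by
  induction n generalizing c ℓ with
  | zero => exact measurable_const
  | succ n ih => exact Measurable.ite (measurableSet_arc _ _) (ih _ _) (ih _ _)

theorem exists_dyadicApprox_eq (f : UnitAddCircle → ℝ) (n : ℕ) (c : UnitAddCircle) (ℓ : ℝ)
    {x : UnitAddCircle} (hx : x ∈ arc c ℓ) :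
    ∃ c', x ∈ arc c' (ℓ / 2 ^ n) ∧
      dyadicApprox f n c ℓ x = ∫ θ, f θ ∂arcMeasure c' (ℓ / 2 ^ n) := by
  induction n generalizing c ℓ with
  | zero => exact ⟨c, by simpa using hx, by simp [dyadicApprox]⟩
  | succ n ih =>
    rw [pow_succ', ← div_div]
    by_cases h : x ∈ arc (c - ((ℓ / 4 : ℝ) : UnitAddCircle)) (ℓ / 2)
    · simpa [dyadicApprox, h] using ih _ _ h
    · have h' : x ∈ arc (c + ((ℓ / 4 : ℝ) : UnitAddCircle)) (ℓ / 2) := by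
        rw [arc_eq_union_halves] at hx
        exact hx.resolve_left h
      simpa [dyadicApprox, h] using ih _ _ h'

theorem tendsto_dyadicApprox {f : UnitAddCircle → ℝ} (hf : Integrable f) (c : UnitAddCircle)
    {ℓ : ℝ} (h0 : 0 < ℓ) :
    ∀ᵐ x, x ∈ arc c ℓ → Tendsto (fun n => dyadicApprox f n c ℓ x) atTop (𝓝 (f x)) := by
  filter_upwards [IsUnifLocDoublingMeasure.ae_tendsto_average (μ := volume)
    hf.locallyIntegrable 1] with x hx hxc
  choose c' hc' h' using fun n => exists_dyadicApprox_eq f n c ℓ hxc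
  simp_rw [h']
  refine hx c' (fun n => ℓ / 2 ^ n / 2) ?_ ?_
  · refine tendsto_nhdsWithin_iff.2 ⟨?_, Eventually.of_forall fun n => ?_⟩
    · have := (tendsto_pow_atTop_nhds_zero_of_lt_one (r := (1 / 2 : ℝ)) (by norm_num)
        (by norm_num)).const_mul (ℓ / 2)
      rw [mul_zero] at this
      refine this.congr fun n => ?_
      rw [div_pow, one_pow]; ring
    · simp only [Set.mem_Ioi]; positivity
  · refine Eventually.of_forall fun n => ?_
    rw [one_mul]; exact hc' n

theorem abs_integral_sub_le {α : Type*} [MeasurableSpace α] {μ : Measure α} [IsProbabilityMeasure μ]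
    {f : α → ℝ} (hf : Integrable f μ) (a : ℝ) : |∫ x, f x ∂μ - a| ≤ ∫ x, |f x - a| ∂μ := by
  have : ∫ x, f x ∂μ - a = ∫ x, (f x - a) ∂μ := by
    rw [integral_sub hf (integrable_const a), integral_const]; simp
  rw [this]
  exact abs_integral_le_integral_abs

/-- The numerical inequality behind the change of reference value in
`lintegral_exp_dyadicApprox_le`, with `l = 4 δ`. -/
theorem exp_restart_le {l : ℝ} (h0 : 0 ≤ l) (h1 : l ≤ 1 / 4) :
    Real.exp (2 * l) * (Real.exp l + 12 * (l / 4)) ≤ Real.exp l + 12 * l := by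
  have e2 : Real.exp (2 * l) ≤ 1 + 4 * l := by
    have := Real.exp_bound_div_one_sub_of_interval (x := 2 * l) (by linarith) (by linarith)
    refine this.trans ?_
    rw [div_le_iff₀ (by linarith)]
    nlinarith
  have e1 : Real.exp l ≤ 4 / 3 := by
    have := Real.exp_bound_div_one_sub_of_interval (x := l) (by linarith) (by linarith)
    refine this.trans ?_
    rw [div_le_iff₀ (by linarith)]
    nlinarith
  have e0 := Real.exp_pos l
  nlinarith [mul_le_mul_of_nonneg_right e2 (by positivity : 0 ≤ Real.exp l + 12 * (l / 4)),
    mul_le_mul_of_nonneg_left e1 h0]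

theorem integral_arcMeasure_eq_halves {g : UnitAddCircle → ℝ} (hg : Integrable g)
    (c : UnitAddCircle) {ℓ : ℝ} (h0 : 0 < ℓ) (h1 : ℓ ≤ 1) :
    ∫ θ, g θ ∂arcMeasure c ℓ =
      (∫ θ, g θ ∂arcMeasure (c - ((ℓ / 4 : ℝ) : UnitAddCircle)) (ℓ / 2) +
        ∫ θ, g θ ∂arcMeasure (c + ((ℓ / 4 : ℝ) : UnitAddCircle)) (ℓ / 2)) / 2 := by
  rw [arcMeasure_eq_halves c h0 h1, integral_smul_measure, integral_add_measure
    (integrable_arcMeasure hg _ (by linarith) (by linarith))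
    (integrable_arcMeasure hg _ (by linarith) (by linarith))]
  simp only [ENNReal.toReal_inv, ENNReal.toReal_ofNat, smul_eq_mul]
  ring

theorem lintegral_dyadicApprox_succ (f : UnitAddCircle → ℝ) (n : ℕ) (G : ℝ → ℝ≥0∞)
    (c : UnitAddCircle) {ℓ : ℝ} (h0 : 0 < ℓ) (h1 : ℓ ≤ 1) :
    ∫⁻ θ, G (dyadicApprox f (n + 1) c ℓ θ) ∂arcMeasure c ℓ =
      2⁻¹ * (∫⁻ θ, G (dyadicApprox f n (c - ((ℓ / 4 : ℝ) : UnitAddCircle)) (ℓ / 2) θ)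
          ∂arcMeasure (c - ((ℓ / 4 : ℝ) : UnitAddCircle)) (ℓ / 2) +
        ∫⁻ θ, G (dyadicApprox f n (c + ((ℓ / 4 : ℝ) : UnitAddCircle)) (ℓ / 2) θ)
          ∂arcMeasure (c + ((ℓ / 4 : ℝ) : UnitAddCircle)) (ℓ / 2)) := by
  rw [arcMeasure_eq_halves c h0 h1, lintegral_smul_measure, lintegral_add_measure, smul_eq_mul]
  congr 2
  · refine lintegral_congr_ae ?_
    rw [arcMeasure_eq _ (by linarith)]
    refine Measure.ae_smul_measure ?_ _
    filter_upwards [ae_restrict_mem (measurableSet_arc _ _)] with x hx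
    simp [dyadicApprox, hx]
  · refine lintegral_congr_ae ?_
    rw [arcMeasure_eq _ (by linarith)]
    refine Measure.ae_smul_measure ?_ _
    have hd : ∀ᵐ x, ¬ (x ∈ arc (c - ((ℓ / 4 : ℝ) : UnitAddCircle)) (ℓ / 2) ∩
        arc (c + ((ℓ / 4 : ℝ) : UnitAddCircle)) (ℓ / 2)) := by
      rw [ae_iff]
      simp only [not_not]
      exact aedisjoint_halves c h0 h1
    filter_upwards [ae_restrict_mem (measurableSet_arc _ _), ae_restrict_of_ae hd] with x hx hx'
    have : x ∉ arc (c - ((ℓ / 4 : ℝ) : UnitAddCircle)) (ℓ / 2) := fun h => hx' ⟨h, hx⟩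
    simp [dyadicApprox, this]

/-- The inductive form of the John–Nirenberg inequality.  The bound is linear in the mean deviation
`A` of `f` from the reference value `a`, hence compatible with halving; as soon as `A` exceeds
`4 δ` on a half, `a` is replaced by the average of `f` over that half, which costs a factor
`exp (8 δ)` but brings the mean deviation down to `δ`. -/
theorem lintegral_exp_dyadicApprox_le {f : UnitAddCircle → ℝ} (hf : Integrable f) {δ ℓ₀ : ℝ}
    (hℓ₀ : ℓ₀ ≤ 1) (hδ : 0 ≤ δ) (hδ' : δ ≤ 1 / 16)
    (hosc : ∀ c, ∀ ℓ ∈ Set.Ioc 0 ℓ₀, meanOscillation f c ℓ ≤ δ) (n : ℕ) (c : UnitAddCircle)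
    (ℓ : ℝ) (hℓ : ℓ ∈ Set.Ioc 0 ℓ₀) (a : ℝ) (ha : ∫ θ, |f θ - a| ∂arcMeasure c ℓ ≤ 4 * δ) :
    ∫⁻ θ, ENNReal.ofReal (Real.exp |dyadicApprox f n c ℓ θ - a|) ∂arcMeasure c ℓ ≤
      ENNReal.ofReal (Real.exp (4 * δ) + 12 * ∫ θ, |f θ - a| ∂arcMeasure c ℓ) := by
  induction n generalizing c ℓ a with
  | zero =>
    have hp := isProbabilityMeasure_arcMeasure c hℓ.1 (hℓ.2.trans hℓ₀)
    have h := abs_integral_sub_le (integrable_arcMeasure hf c hℓ.1 (hℓ.2.trans hℓ₀)) a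
    have h2 : 0 ≤ ∫ θ, |f θ - a| ∂arcMeasure c ℓ := integral_nonneg fun _ => abs_nonneg _
    simp only [dyadicApprox, lintegral_const, measure_univ, mul_one]
    refine ENNReal.ofReal_le_ofReal ?_
    have := Real.exp_le_exp.2 (h.trans ha)
    linarith
  | succ n ih =>
    have hga : Integrable (fun θ => |f θ - a|) := (hf.sub (integrable_const a)).abs
    have hsplit := integral_arcMeasure_eq_halves hga c hℓ.1 (hℓ.2.trans hℓ₀)
    have key : ∀ c', ∫ θ, |f θ - a| ∂arcMeasure c' (ℓ / 2) ≤ 8 * δ →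
        ∫⁻ θ, ENNReal.ofReal (Real.exp |dyadicApprox f n c' (ℓ / 2) θ - a|)
          ∂arcMeasure c' (ℓ / 2) ≤
        ENNReal.ofReal (Real.exp (4 * δ) + 12 * ∫ θ, |f θ - a| ∂arcMeasure c' (ℓ / 2)) := by
      intro c' hc'
      have hℓ' : ℓ / 2 ∈ Set.Ioc 0 ℓ₀ := ⟨by linarith [hℓ.1], by linarith [hℓ.1, hℓ.2]⟩
      rcases le_or_gt (∫ θ, |f θ - a| ∂arcMeasure c' (ℓ / 2)) (4 * δ) with h | h
      · exact ih c' _ hℓ' a h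
      · -- the mean deviation from `a` is too large: pass to the average `b` over this half
        have hp := isProbabilityMeasure_arcMeasure c' hℓ'.1 (hℓ'.2.trans hℓ₀)
        set b := ∫ θ, f θ ∂arcMeasure c' (ℓ / 2) with hb
        have hba : |b - a| ≤ 2 * (4 * δ) :=
          (abs_integral_sub_le (integrable_arcMeasure hf c' hℓ'.1 (hℓ'.2.trans hℓ₀)) a).trans
            (by linarith)
        have hbδ : ∫ θ, |f θ - b| ∂arcMeasure c' (ℓ / 2) ≤ δ := hosc c' _ hℓ'
        have h1 := ih c' _ hℓ' b (by linarith)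
        calc ∫⁻ θ, ENNReal.ofReal (Real.exp |dyadicApprox f n c' (ℓ / 2) θ - a|)
              ∂arcMeasure c' (ℓ / 2)
            ≤ ∫⁻ θ, ENNReal.ofReal (Real.exp (2 * (4 * δ))) *
                ENNReal.ofReal (Real.exp |dyadicApprox f n c' (ℓ / 2) θ - b|)
              ∂arcMeasure c' (ℓ / 2) := by
              refine lintegral_mono fun θ => ?_
              rw [← ENNReal.ofReal_mul (Real.exp_nonneg _), ← Real.exp_add]
              refine ENNReal.ofReal_le_ofReal (Real.exp_le_exp.2 ?_)
              have := abs_sub_le (dyadicApprox f n c' (ℓ / 2) θ) b a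
              linarith
          _ = ENNReal.ofReal (Real.exp (2 * (4 * δ))) *
                ∫⁻ θ, ENNReal.ofReal (Real.exp |dyadicApprox f n c' (ℓ / 2) θ - b|)
              ∂arcMeasure c' (ℓ / 2) := lintegral_const_mul' _ _ ENNReal.ofReal_ne_top
          _ ≤ ENNReal.ofReal (Real.exp (2 * (4 * δ))) *
                ENNReal.ofReal (Real.exp (4 * δ) + 12 * (4 * δ / 4)) := by
              gcongr
              refine h1.trans (ENNReal.ofReal_le_ofReal ?_)
              linarith
          _ ≤ _ := by
              rw [← ENNReal.ofReal_mul (Real.exp_nonneg _)]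
              refine ENNReal.ofReal_le_ofReal
                ((exp_restart_le (by linarith only [hδ]) (by linarith)).trans ?_)
              linarith
    have hn : ∀ c', 0 ≤ ∫ θ, |f θ - a| ∂arcMeasure c' (ℓ / 2) :=
      fun c' => integral_nonneg fun _ => abs_nonneg _
    have hn1 := hn (c - ((ℓ / 4 : ℝ) : UnitAddCircle))
    have hn2 := hn (c + ((ℓ / 4 : ℝ) : UnitAddCircle))
    have k1 := key (c - ((ℓ / 4 : ℝ) : UnitAddCircle)) (by linarith)
    have k2 := key (c + ((ℓ / 4 : ℝ) : UnitAddCircle)) (by linarith)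
    rw [lintegral_dyadicApprox_succ f n (fun t => ENNReal.ofReal (Real.exp |t - a|)) c hℓ.1
      (hℓ.2.trans hℓ₀)]
    refine (mul_le_mul_right (add_le_add k1 k2) _).trans ?_
    rw [← ENNReal.ofReal_add (by positivity) (by positivity), hsplit, ← ENNReal.ofReal_ofNat,
      ← ENNReal.ofReal_inv_of_pos two_pos, ← ENNReal.ofReal_mul (by norm_num)]
    refine ENNReal.ofReal_le_ofReal (le_of_eq ?_)
    ring

/-- **John–Nirenberg inequality** for a function of mean oscillation at most `δ ≤ 1 / 16` on all
sufficiently short arcs.  It follows from the bound for the dyadic approximations by the Lebesgue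
differentiation theorem and Fatou's lemma. -/
theorem lintegral_exp_sub_average_le {f : UnitAddCircle → ℝ} (hf : Integrable f) {δ ℓ₀ : ℝ}
    (hℓ₀ : ℓ₀ ≤ 1) (hδ : 0 ≤ δ) (hδ' : δ ≤ 1 / 16)
    (hosc : ∀ c, ∀ ℓ ∈ Set.Ioc 0 ℓ₀, meanOscillation f c ℓ ≤ δ) (c : UnitAddCircle)
    {ℓ : ℝ} (hℓ : ℓ ∈ Set.Ioc 0 ℓ₀) :
    ∫⁻ θ, ENNReal.ofReal (Real.exp |f θ - ∫ η, f η ∂arcMeasure c ℓ|) ∂arcMeasure c ℓ ≤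
      ENNReal.ofReal (1 + 20 * δ) := by
  set a := ∫ η, f η ∂arcMeasure c ℓ with ha
  have hosc' : ∫ θ, |f θ - a| ∂arcMeasure c ℓ ≤ δ := hosc c ℓ hℓ
  have hlim : ∀ᵐ θ ∂arcMeasure c ℓ, Tendsto
      (fun n => ENNReal.ofReal (Real.exp |dyadicApprox f n c ℓ θ - a|)) atTop
      (𝓝 (ENNReal.ofReal (Real.exp |f θ - a|))) := by
    rw [arcMeasure_eq _ (hℓ.2.trans hℓ₀)]
    refine Measure.ae_smul_measure ?_ _
    filter_upwards [ae_restrict_mem (measurableSet_arc c ℓ),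
      ae_restrict_of_ae (tendsto_dyadicApprox hf c hℓ.1)] with x hx hx'
    have := hx' hx
    exact ENNReal.tendsto_ofReal (Real.continuous_exp.continuousAt.tendsto.comp
      ((this.sub_const a).abs))
  calc ∫⁻ θ, ENNReal.ofReal (Real.exp |f θ - a|) ∂arcMeasure c ℓ
      = ∫⁻ θ, liminf (fun n => ENNReal.ofReal (Real.exp |dyadicApprox f n c ℓ θ - a|)) atTop
          ∂arcMeasure c ℓ := by
        refine lintegral_congr_ae ?_
        filter_upwards [hlim] with x hx using hx.liminf_eq.symm
    _ ≤ liminf (fun n => ∫⁻ θ, ENNReal.ofReal (Real.exp |dyadicApprox f n c ℓ θ - a|)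
          ∂arcMeasure c ℓ) atTop := by
        refine lintegral_liminf_le fun n => ?_
        have := measurable_dyadicApprox f n c ℓ
        fun_prop
    _ ≤ ENNReal.ofReal (1 + 20 * δ) := by
        refine liminf_le_of_le (by isBoundedDefault) fun b hb => ?_
        obtain ⟨n, hn⟩ := hb.exists
        refine hn.trans ((lintegral_exp_dyadicApprox_le hf hℓ₀ hδ hδ' hosc n c ℓ hℓ a
          (by linarith)).trans (ENNReal.ofReal_le_ofReal ?_))
        have := Real.exp_bound_div_one_sub_of_interval (x := 4 * δ) (by linarith) (by linarith)
        have h2 : 1 / (1 - 4 * δ) ≤ 1 + 8 * δ := by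
          rw [div_le_iff₀ (by linarith)]
          nlinarith
        linarith

/-! ### The product of the means of a weight and of its inverse -/

section Weights

variable {α : Type*} [MeasurableSpace α]

theorem inv_ofReal_exp (x : ℝ) :
    (ENNReal.ofReal (Real.exp x))⁻¹ = ENNReal.ofReal (Real.exp (-x)) := by
  rw [Real.exp_neg, ENNReal.ofReal_inv_of_pos (Real.exp_pos x)]

/-- The Cauchy–Schwarz inequality for `w ^ (1 / 2)` and `w ^ (-1 / 2)`. -/
theorem one_le_lintegral_mul_lintegral_inv {μ : Measure α} [IsProbabilityMeasure μ]
    {w : α → ℝ≥0∞} (hw : AEMeasurable w μ) (h : ∀ᵐ x ∂μ, w x ≠ 0 ∧ w x ≠ ∞) :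
    1 ≤ (∫⁻ x, w x ∂μ) * ∫⁻ x, (w x)⁻¹ ∂μ := by
  have hC := ENNReal.lintegral_mul_le_Lp_mul_Lq μ Real.HolderConjugate.two_two
    (f := fun x => w x ^ (1 / 2 : ℝ)) (g := fun x => (w x)⁻¹ ^ (1 / 2 : ℝ))
    (hw.pow_const _) (hw.inv.pow_const _)
  have hl : ∫⁻ x, ((fun x => w x ^ (1 / 2 : ℝ)) * fun x => (w x)⁻¹ ^ (1 / 2 : ℝ)) x ∂μ = 1 := by
    rw [← measure_univ (μ := μ), ← lintegral_one]
    refine lintegral_congr_ae ?_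
    filter_upwards [h] with x hx
    rw [Pi.mul_apply, ← ENNReal.mul_rpow_of_nonneg _ _ (by norm_num),
      ENNReal.mul_inv_cancel hx.1 hx.2, ENNReal.one_rpow]
  rw [hl, ← ENNReal.mul_rpow_of_nonneg _ _ (by norm_num)] at hC
  simp only [← ENNReal.rpow_mul] at hC
  norm_num at hC
  by_contra! hlt
  exact absurd (ENNReal.rpow_lt_one hlt (by norm_num : (0 : ℝ) < 1 / 2)) (by simpa using hC)

/-- If the means of `w` and `w⁻¹` have a finite product, then either `w` is positive and finite, or
one of the means vanishes, because of the convention `0 * ∞ = 0`. -/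
theorem ae_trichotomy {μ : Measure α} {w : α → ℝ≥0∞} (hw : AEMeasurable w μ)
    (h : (∫⁻ x, w x ∂μ) * ∫⁻ x, (w x)⁻¹ ∂μ ≠ ∞) :
    (∀ᵐ x ∂μ, w x ≠ 0 ∧ w x ≠ ∞) ∨ (∀ᵐ x ∂μ, w x = 0) ∨ ∀ᵐ x ∂μ, w x = ∞ := by
  by_cases h1 : ∫⁻ x, (w x)⁻¹ ∂μ = 0
  · right; right
    filter_upwards [(lintegral_eq_zero_iff' hw.inv).1 h1] with x hx
    simpa using hx
  by_cases h0 : ∫⁻ x, w x ∂μ = 0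
  · right; left
    filter_upwards [(lintegral_eq_zero_iff' hw).1 h0] with x hx using hx
  left
  have h0' : ∫⁻ x, w x ∂μ ≠ ∞ := fun ht => h (by rw [ht, ENNReal.top_mul h1])
  have h1' : ∫⁻ x, (w x)⁻¹ ∂μ ≠ ∞ := fun ht => h (by rw [ht, ENNReal.mul_top h0])
  filter_upwards [ae_lt_top' hw h0', ae_lt_top' hw.inv h1'] with x hx hx'
  exact ⟨(by simpa using hx' : 0 < w x).ne', hx.ne⟩

theorem half_sq_add_two_le (x : ℝ) : x ^ 2 / 2 + 2 ≤ Real.exp x + Real.exp (-x) := by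
  have h : ∀ y : ℝ, 0 ≤ y → y ^ 2 / 2 + 2 ≤ Real.exp y + Real.exp (-y) := fun y hy => by
    have := Real.quadratic_le_exp_of_nonneg hy
    have := Real.add_one_le_exp (-y)
    linarith
  rcases le_total 0 x with hx | hx
  · exact h x hx
  · have := h (-x) (by linarith)
    rw [neg_neg] at this
    linarith [neg_sq x]

/-- With `a` such that `exp (φ - a)` and `exp (-(φ - a))` have the same mean, their sum controls
`(φ - a) ^ 2`. -/
theorem exists_lintegral_sq_sub_le {μ : Measure α} [IsProbabilityMeasure μ] {φ : α → ℝ}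
    (hφ : AEMeasurable φ μ) {ε : ℝ} (hε : 0 ≤ ε)
    (h : (∫⁻ x, ENNReal.ofReal (Real.exp (φ x)) ∂μ) *
      ∫⁻ x, ENNReal.ofReal (Real.exp (-φ x)) ∂μ ≤ ENNReal.ofReal (1 + ε)) :
    ∃ a : ℝ, ∫⁻ x, ENNReal.ofReal ((φ x - a) ^ 2) ∂μ ≤ ENNReal.ofReal (2 * ε) := by
  set X := ∫⁻ x, ENNReal.ofReal (Real.exp (φ x)) ∂μ with hX
  set Y := ∫⁻ x, ENNReal.ofReal (Real.exp (-φ x)) ∂μ with hY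
  have hne : ∀ ψ : α → ℝ, AEMeasurable ψ μ → ∫⁻ x, ENNReal.ofReal (Real.exp (ψ x)) ∂μ ≠ 0 := by
    intro ψ hψ h0
    rw [lintegral_eq_zero_iff' (by fun_prop)] at h0
    obtain ⟨x, hx⟩ := h0.exists
    simp only [Pi.zero_apply, ENNReal.ofReal_eq_zero] at hx
    exact absurd (Real.exp_pos (ψ x)) (not_lt.2 hx)
  have hX0 : X ≠ 0 := hne φ hφ
  have hY0 : Y ≠ 0 := hne _ hφ.neg
  have hXY : X * Y ≠ ∞ := (h.trans_lt ENNReal.ofReal_lt_top).ne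
  have hXt : X ≠ ∞ := fun ht => hXY (by rw [ht, ENNReal.top_mul hY0])
  have hYt : Y ≠ ∞ := fun ht => hXY (by rw [ht, ENNReal.mul_top hX0])
  set x := X.toReal with hx
  set y := Y.toReal with hy
  have hx0 : 0 < x := ENNReal.toReal_pos hX0 hXt
  have hy0 : 0 < y := ENNReal.toReal_pos hY0 hYt
  have hxX : X = ENNReal.ofReal x := (ENNReal.ofReal_toReal hXt).symm
  have hyY : Y = ENNReal.ofReal y := (ENNReal.ofReal_toReal hYt).symm
  -- `s` is the geometric mean of `x` and `y`, and `exp a = √(x / y)`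
  have hxy : x * y ≤ 1 + ε := by
    rw [hxX, hyY, ← ENNReal.ofReal_mul hx0.le] at h
    exact (ENNReal.ofReal_le_ofReal_iff (by linarith)).1 h
  set s := Real.exp ((Real.log x + Real.log y) / 2) with hs
  have hss : s ^ 2 ≤ 1 + ε := by
    rw [hs, ← Real.exp_nat_mul]
    push_cast
    rw [mul_div_cancel₀ _ (two_ne_zero), Real.exp_add, Real.exp_log hx0, Real.exp_log hy0]
    exact hxy
  have hs0 : 0 < s := Real.exp_pos _
  have hs1 : s ≤ 1 + ε / 2 := by nlinarith
  set a := (Real.log x - Real.log y) / 2 with ha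
  refine ⟨a, ?_⟩
  have e1 : ∫⁻ z, ENNReal.ofReal (Real.exp (φ z - a)) ∂μ = ENNReal.ofReal s := by
    have : ∀ z, ENNReal.ofReal (Real.exp (φ z - a)) =
        ENNReal.ofReal (Real.exp (-a)) * ENNReal.ofReal (Real.exp (φ z)) := fun z => by
      rw [← ENNReal.ofReal_mul (Real.exp_nonneg _), ← Real.exp_add]; ring_nf
    simp_rw [this]
    rw [lintegral_const_mul' _ _ ENNReal.ofReal_ne_top, ← hX, hxX,
      ← ENNReal.ofReal_mul (Real.exp_nonneg _)]
    nth_rewrite 1 [← Real.exp_log hx0]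
    rw [← Real.exp_add, hs, ha]; ring_nf
  have e2 : ∫⁻ z, ENNReal.ofReal (Real.exp (-(φ z - a))) ∂μ = ENNReal.ofReal s := by
    have : ∀ z, ENNReal.ofReal (Real.exp (-(φ z - a))) =
        ENNReal.ofReal (Real.exp a) * ENNReal.ofReal (Real.exp (-φ z)) := fun z => by
      rw [← ENNReal.ofReal_mul (Real.exp_nonneg _), ← Real.exp_add]; ring_nf
    simp_rw [this]
    rw [lintegral_const_mul' _ _ ENNReal.ofReal_ne_top, ← hY, hyY,
      ← ENNReal.ofReal_mul (Real.exp_nonneg _)]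
    nth_rewrite 1 [← Real.exp_log hy0]
    rw [← Real.exp_add, hs, ha]; ring_nf
  have hpt : ∀ z, ENNReal.ofReal ((φ z - a) ^ 2) + 4 ≤
      2 * (ENNReal.ofReal (Real.exp (φ z - a)) + ENNReal.ofReal (Real.exp (-(φ z - a)))) := by
    intro z
    rw [← ENNReal.ofReal_add (Real.exp_nonneg _) (Real.exp_nonneg _), ← ENNReal.ofReal_ofNat 4,
      ← ENNReal.ofReal_ofNat 2, ← ENNReal.ofReal_add (sq_nonneg _) (by norm_num),
      ← ENNReal.ofReal_mul (by norm_num)]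
    refine ENNReal.ofReal_le_ofReal ?_
    linarith [half_sq_add_two_le (φ z - a)]
  have hint : ∫⁻ z, ENNReal.ofReal ((φ z - a) ^ 2) ∂μ + 4 ≤ ENNReal.ofReal (2 * ε) + 4 := by
    calc ∫⁻ z, ENNReal.ofReal ((φ z - a) ^ 2) ∂μ + 4
        = ∫⁻ z, (ENNReal.ofReal ((φ z - a) ^ 2) + 4) ∂μ := by
          rw [lintegral_add_right _ measurable_const]; simp
      _ ≤ ∫⁻ z, 2 * (ENNReal.ofReal (Real.exp (φ z - a)) +
            ENNReal.ofReal (Real.exp (-(φ z - a)))) ∂μ := lintegral_mono hpt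
      _ = 2 * (ENNReal.ofReal s + ENNReal.ofReal s) := by
          rw [lintegral_const_mul' _ _ (by simp), lintegral_add_left' (by fun_prop), e1, e2]
      _ ≤ ENNReal.ofReal (2 * ε) + 4 := by
          rw [← ENNReal.ofReal_ofNat 4, ← ENNReal.ofReal_ofNat 2,
            ← ENNReal.ofReal_add hs0.le hs0.le,
            ← ENNReal.ofReal_mul (by norm_num), ← ENNReal.ofReal_add (by linarith) (by norm_num)]
          exact ENNReal.ofReal_le_ofReal (by linarith)
  exact (ENNReal.add_le_add_iff_right (by simp)).1 hint

theorem lintegral_exp_mul_lintegral_exp_neg_le {μ : Measure α} {φ : α → ℝ} {a ε : ℝ} (hε : 0 ≤ ε)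
    (h : ∫⁻ x, ENNReal.ofReal (Real.exp |φ x - a|) ∂μ ≤ ENNReal.ofReal (1 + ε)) :
    (∫⁻ x, ENNReal.ofReal (Real.exp (φ x)) ∂μ) * ∫⁻ x, ENNReal.ofReal (Real.exp (-φ x)) ∂μ ≤
      ENNReal.ofReal ((1 + ε) ^ 2) := by
  have key : ∀ (ψ : α → ℝ) (b : ℝ), (∀ x, ψ x ≤ b + |φ x - a|) →
      ∫⁻ x, ENNReal.ofReal (Real.exp (ψ x)) ∂μ ≤
        ENNReal.ofReal (Real.exp b) * ENNReal.ofReal (1 + ε) := by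
    intro ψ b hψ
    calc ∫⁻ x, ENNReal.ofReal (Real.exp (ψ x)) ∂μ
        ≤ ∫⁻ x, ENNReal.ofReal (Real.exp b) * ENNReal.ofReal (Real.exp |φ x - a|) ∂μ := by
          refine lintegral_mono fun x => ?_
          rw [← ENNReal.ofReal_mul (Real.exp_nonneg _), ← Real.exp_add]
          exact ENNReal.ofReal_le_ofReal (Real.exp_le_exp.2 (hψ x))
      _ ≤ _ := by
          rw [lintegral_const_mul' _ _ ENNReal.ofReal_ne_top]
          gcongr
  refine (mul_le_mul' (key φ a fun x => by linarith [le_abs_self (φ x - a)])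
    (key (fun x => -φ x) (-a) fun x => by linarith [neg_abs_le (φ x - a)])).trans (le_of_eq ?_)
  rw [← ENNReal.ofReal_mul (Real.exp_nonneg _), ← ENNReal.ofReal_mul (Real.exp_nonneg _),
    ← ENNReal.ofReal_mul (by positivity)]
  congr 1
  rw [mul_mul_mul_comm, ← Real.exp_add]
  simp [sq]

theorem limsup_eq_one_iff {ι : Type*} {F : Filter ι} [F.NeBot] {u : ι → ℝ≥0∞}
    (h1 : ∀ᶠ i in F, 1 ≤ u i) :
    limsup u F = 1 ↔ ∀ ε : ℝ, 0 < ε → ∀ᶠ i in F, u i ≤ ENNReal.ofReal (1 + ε) := by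
  constructor
  · intro h ε hε
    have : limsup u F < ENNReal.ofReal (1 + ε) := by
      rw [h, ← ENNReal.ofReal_one]
      exact (ENNReal.ofReal_lt_ofReal_iff (by linarith)).2 (by linarith)
    exact (eventually_lt_of_limsup_lt this).mono fun _ => le_of_lt
  · intro h
    refine le_antisymm ?_ (le_limsup_of_frequently_le' h1.frequently)
    refine ENNReal.le_of_forall_pos_le_add fun ε hε _ => ?_
    refine limsup_le_of_le (by isBoundedDefault) ((h ε hε).mono fun i hi => hi.trans (le_of_eq ?_))
    rw [ENNReal.ofReal_add zero_le_one ε.coe_nonneg, ENNReal.ofReal_one, ENNReal.ofReal_coe_nnreal]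

theorem integrable_of_lintegral_sq_sub {μ : Measure α} [IsProbabilityMeasure μ] {φ : α → ℝ}
    (hφ : AEStronglyMeasurable φ μ) {a C : ℝ}
    (h : ∫⁻ x, ENNReal.ofReal ((φ x - a) ^ 2) ∂μ ≤ ENNReal.ofReal C) :
    Integrable (fun x => (φ x - a) ^ 2) μ ∧ Integrable φ μ := by
  have h2 : Integrable (fun x => (φ x - a) ^ 2) μ := by
    refine ⟨(hφ.sub aestronglyMeasurable_const).pow 2, ?_⟩
    rw [hasFiniteIntegral_iff_ofReal (Eventually.of_forall fun x => sq_nonneg _)]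
    exact h.trans_lt ENNReal.ofReal_lt_top
  refine ⟨h2, ?_⟩
  refine ((h2.add (integrable_const (1 + |a|))).mono' hφ (Eventually.of_forall fun x => ?_))
  simp only [Pi.add_apply, Real.norm_eq_abs]
  have := abs_sub_abs_le_abs_sub (φ x) a
  nlinarith [sq_abs (φ x - a), sq_nonneg (|φ x - a| - 1)]

theorem integral_abs_sub_average_le {μ : Measure α} [IsProbabilityMeasure μ] {φ : α → ℝ}
    (hφ : AEStronglyMeasurable φ μ) {a ε : ℝ} (hε : 0 < ε)
    (h : ∫⁻ x, ENNReal.ofReal ((φ x - a) ^ 2) ∂μ ≤ ENNReal.ofReal (ε ^ 2)) :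
    ∫ x, |φ x - ∫ y, φ y ∂μ| ∂μ ≤ 2 * ε := by
  obtain ⟨h2, h1⟩ := integrable_of_lintegral_sq_sub hφ h
  have hi2 : ∫ x, (φ x - a) ^ 2 ∂μ ≤ ε ^ 2 := by
    rw [integral_eq_lintegral_of_nonneg_ae (Eventually.of_forall fun x => sq_nonneg _)
      h2.aestronglyMeasurable]
    exact ENNReal.toReal_le_of_le_ofReal (sq_nonneg _) h
  have ha : Integrable (fun x => |φ x - a|) μ := (h1.sub (integrable_const a)).abs
  have hi1 : ∫ x, |φ x - a| ∂μ ≤ ε := by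
    have : ∫ x, 2 * ε * |φ x - a| ∂μ ≤ ∫ x, ((φ x - a) ^ 2 + ε ^ 2) ∂μ := by
      refine integral_mono (ha.const_mul _) (h2.add (integrable_const _)) fun x => ?_
      simp only
      nlinarith [sq_abs (φ x - a), sq_nonneg (|φ x - a| - ε)]
    rw [integral_const_mul, integral_add h2 (integrable_const _), integral_const] at this
    simp only [probReal_univ, one_smul] at this
    nlinarith
  have hm := abs_integral_sub_le h1 a
  calc ∫ x, |φ x - ∫ y, φ y ∂μ| ∂μ ≤ ∫ x, (|φ x - a| + |∫ y, φ y ∂μ - a|) ∂μ := by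
        refine integral_mono (h1.sub (integrable_const _)).abs (ha.add (integrable_const _))
          fun x => ?_
        simp only
        rw [abs_sub_comm (∫ y, φ y ∂μ) a]
        exact abs_sub_le _ _ _
    _ = ∫ x, |φ x - a| ∂μ + |∫ y, φ y ∂μ - a| := by
        rw [integral_add ha (integrable_const _), integral_const]; simp
    _ ≤ 2 * ε := by linarith

end Weights

/-! ### Criteria on arcs -/

theorem eventually_arcsShrinking {p : UnitAddCircle × ℝ → Prop} :
    (∀ᶠ I in arcsShrinking, p I) ↔ ∃ ℓ₀ ∈ Set.Ioc (0 : ℝ) 1, ∀ c, ∀ ℓ ∈ Set.Ioc 0 ℓ₀, p (c, ℓ) := by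
  have : (∀ᶠ I in arcsShrinking, p I) ↔ ∀ᶠ ℓ in 𝓝[>] (0 : ℝ), ∀ c, p (c, ℓ) := by
    rw [arcsShrinking, top_prod, eventually_comap]
    constructor
    · exact fun h => h.mono fun ℓ hℓ c => hℓ (c, ℓ) rfl
    · rintro h
      refine h.mono ?_
      rintro _ hℓ ⟨c, ℓ⟩ rfl
      exact hℓ c
  rw [this]
  constructor
  · intro h
    obtain ⟨u, hu, hu'⟩ := mem_nhdsGT_iff_exists_Ioc_subset.1 h
    refine ⟨min u 1, ⟨lt_min hu one_pos, min_le_right _ _⟩, fun c ℓ hℓ => ?_⟩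
    exact hu' ⟨hℓ.1, hℓ.2.trans (min_le_left _ _)⟩ c
  · rintro ⟨ℓ₀, h0, h⟩
    filter_upwards [Ioc_mem_nhdsGT h0.1] with ℓ hℓ c using h c ℓ hℓ

instance : arcsShrinking.NeBot := by
  rw [arcsShrinking]
  infer_instance

theorem arc_mem_nhds (c : UnitAddCircle) {ℓ : ℝ} (h0 : 0 < ℓ) : arc c ℓ ∈ 𝓝 c :=
  Metric.closedBall_mem_nhds c (by linarith)

/-- A property that holds almost everywhere on every arc of some length holds almost everywhere. -/
theorem ae_of_forall_ae_arc {p : UnitAddCircle → Prop} {ℓ : ℝ} (h0 : 0 < ℓ) (h1 : ℓ ≤ 1)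
    (h : ∀ c, ∀ᵐ x ∂arcMeasure c ℓ, p x) : ∀ᵐ x, p x := by
  rw [ae_iff]
  refine measure_null_of_locally_null _ fun c _ => ?_
  refine ⟨{x | ¬ p x} ∩ arc c ℓ, inter_mem self_mem_nhdsWithin
    (mem_nhdsWithin_of_mem_nhds (arc_mem_nhds c h0)), ?_⟩
  have hc : ∀ᵐ x ∂volume.restrict (arc c ℓ), p x := by
    rw [restrict_arc_eq_smul c h0 h1]
    exact Measure.ae_smul_measure (h c) _
  rwa [ae_iff, Measure.restrict_apply' (measurableSet_arc c ℓ)] at hc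

theorem integrable_of_forall_arc {f : UnitAddCircle → ℝ} {ℓ : ℝ} (h0 : 0 < ℓ) (h1 : ℓ ≤ 1)
    (h : ∀ c, Integrable f (arcMeasure c ℓ)) : Integrable f := by
  have hl : LocallyIntegrable f := fun c => ⟨arc c ℓ, arc_mem_nhds c h0, by
    rw [IntegrableOn, restrict_arc_eq_smul c h0 h1]
    exact (h c).smul_measure ENNReal.ofReal_ne_top⟩
  exact integrableOn_univ.1 (hl.integrableOn_isCompact isCompact_univ)

theorem integral_arcMeasure_le {g : UnitAddCircle → ℝ} (hg : Integrable g) (hg0 : ∀ x, 0 ≤ g x)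
    (c : UnitAddCircle) {ℓ : ℝ} (h0 : 0 < ℓ) (h1 : ℓ ≤ 1) :
    ∫ x, g x ∂arcMeasure c ℓ ≤ (∫ x, g x) / ℓ := by
  rw [arcMeasure_eq c h1, integral_smul_measure, ENNReal.toReal_inv, ENNReal.toReal_ofReal h0.le,
    smul_eq_mul, div_eq_inv_mul]
  have : 0 ≤ ℓ⁻¹ := by positivity
  exact mul_le_mul_of_nonneg_left
    (setIntegral_le_integral hg (Eventually.of_forall hg0)) this

/-- Small mean square deviations from suitable constants on all short arcs give `VMO`; the constants
need not be the averages, and the arcs that are not short are handled by integrability. -/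
theorem isVMO_of_lintegral_sq_sub_le {φ : UnitAddCircle → ℝ} (hφ : AEMeasurable φ)
    (h : ∀ ε : ℝ, 0 < ε → ∃ ℓ₀ ∈ Set.Ioc (0 : ℝ) 1, ∀ c, ∀ ℓ ∈ Set.Ioc 0 ℓ₀, ∃ a : ℝ,
      ∫⁻ x, ENNReal.ofReal ((φ x - a) ^ 2) ∂arcMeasure c ℓ ≤ ENNReal.ofReal ε) : IsVMO φ := by
  have hm : ∀ c ℓ, ℓ ≤ 1 → AEStronglyMeasurable φ (arcMeasure c ℓ) := fun c ℓ h1 =>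
    hφ.aestronglyMeasurable.mono_ac (arcMeasure_absolutelyContinuous c h1)
  have hosc : ∀ ε : ℝ, 0 < ε → ∃ ℓ₀ ∈ Set.Ioc (0 : ℝ) 1, ∀ c, ∀ ℓ ∈ Set.Ioc 0 ℓ₀,
      meanOscillation φ c ℓ ≤ ε := by
    intro ε hε
    obtain ⟨ℓ₀, h0, h'⟩ := h ((ε / 2) ^ 2) (by positivity)
    refine ⟨ℓ₀, h0, fun c ℓ hℓ => ?_⟩
    obtain ⟨a, ha⟩ := h' c ℓ hℓ
    have hp := isProbabilityMeasure_arcMeasure c hℓ.1 (hℓ.2.trans h0.2)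
    rw [meanOscillation_eq]
    have := integral_abs_sub_average_le (hm c ℓ (hℓ.2.trans h0.2)) (by positivity) ha
    linarith
  have hint : Integrable φ := by
    obtain ⟨ℓ₀, h0, h'⟩ := h 1 one_pos
    refine integrable_of_forall_arc h0.1 h0.2 fun c => ?_
    obtain ⟨a, ha⟩ := h' c ℓ₀ ⟨h0.1, le_rfl⟩
    have hp := isProbabilityMeasure_arcMeasure c h0.1 h0.2
    exact (integrable_of_lintegral_sq_sub (hm c ℓ₀ h0.2) ha).2
  refine ⟨⟨hint, ?_⟩, ?_⟩
  · obtain ⟨ℓ₀, h0, h'⟩ := hosc 1 one_pos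
    refine ⟨max 1 (2 * ((∫ x, |φ x|) / ℓ₀)), fun c ℓ hℓ => ?_⟩
    rcases le_or_gt ℓ ℓ₀ with hl | hl
    · exact (h' c ℓ ⟨hℓ.1, hl⟩).trans (le_max_left _ _)
    · refine le_trans ?_ (le_max_right _ _)
      have hp := isProbabilityMeasure_arcMeasure c hℓ.1 hℓ.2
      have hi := integrable_arcMeasure hint c hℓ.1 hℓ.2
      have hb : ∫ x, |φ x| ∂arcMeasure c ℓ ≤ (∫ x, |φ x|) / ℓ₀ :=
        (integral_arcMeasure_le hint.abs (fun x => abs_nonneg _) c hℓ.1 hℓ.2).trans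
          (div_le_div_of_nonneg_left (integral_nonneg fun x => abs_nonneg _) h0.1 hl.le)
      have ha : |∫ x, φ x ∂arcMeasure c ℓ| ≤ ∫ x, |φ x| ∂arcMeasure c ℓ :=
        abs_integral_le_integral_abs
      rw [meanOscillation_eq]
      calc _ ≤ ∫ x, (|φ x| + |∫ y, φ y ∂arcMeasure c ℓ|) ∂arcMeasure c ℓ :=
            integral_mono (hi.sub (integrable_const _)).abs (hi.abs.add (integrable_const _))
              fun x => abs_sub _ _
        _ = ∫ x, |φ x| ∂arcMeasure c ℓ + |∫ x, φ x ∂arcMeasure c ℓ| := by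
            rw [integral_add hi.abs (integrable_const _), integral_const]; simp
        _ ≤ _ := by linarith
  · rw [Metric.tendsto_nhds]
    intro ε hε
    obtain ⟨ℓ₀, h0, h'⟩ := hosc (ε / 2) (by linarith)
    refine eventually_arcsShrinking.2 ⟨ℓ₀, h0, fun c ℓ hℓ => ?_⟩
    have hn : 0 ≤ meanOscillation φ c ℓ := integral_nonneg fun _ => abs_nonneg _
    rw [Real.dist_eq, sub_zero, abs_of_nonneg hn]
    linarith [h' c ℓ hℓ]

/-- If the products of means over all arcs of a fixed length are finite, then the alternative of
`ae_trichotomy` is the same for all these arcs, because neighbouring arcs overlap and the circle is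
connected. -/
theorem ae_trichotomy_of_arcs {w : UnitAddCircle → ℝ≥0∞} (hw : AEMeasurable w) {ℓ : ℝ}
    (h0 : 0 < ℓ) (h1 : ℓ ≤ 1)
    (h : ∀ c, (∫⁻ x, w x ∂arcMeasure c ℓ) * ∫⁻ x, (w x)⁻¹ ∂arcMeasure c ℓ ≠ ∞) :
    (∀ᵐ x, w x ≠ 0 ∧ w x ≠ ∞) ∨ (∀ᵐ x, w x = 0) ∨ ∀ᵐ x, w x = ∞ := by
  have htri := fun c => ae_trichotomy (hw.mono_ac (arcMeasure_absolutelyContinuous c h1)) (h c)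
  -- neighbouring arcs share a ball, so incompatible properties cannot hold a.e. on both
  have hoverlap : ∀ p q : UnitAddCircle → Prop, (∀ x, p x → ¬ q x) → ∀ c d, dist d c < ℓ / 2 →
      (∀ᵐ x ∂arcMeasure c ℓ, p x) → ¬ ∀ᵐ x ∂arcMeasure d ℓ, q x := by
    intro p q hpq c d hcd hp hq
    have hp' : ∀ᵐ x ∂volume.restrict (arc c ℓ), p x := by
      rw [restrict_arc_eq_smul c h0 h1]; exact Measure.ae_smul_measure hp _
    have hq' : ∀ᵐ x ∂volume.restrict (arc d ℓ), q x := by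
      rw [restrict_arc_eq_smul d h0 h1]; exact Measure.ae_smul_measure hq _
    rw [ae_restrict_iff' (measurableSet_arc _ _)] at hp' hq'
    have hb : volume (Metric.ball d (ℓ / 2 - dist d c)) = 0 := by
      refine measure_mono_null ?_ (ae_iff.1 (hp'.and hq'))
      intro x hx
      have hx' : dist x d < ℓ / 2 - dist d c := hx
      simp only [Set.mem_ofPred_eq, arc, Metric.mem_closedBall]
      rintro ⟨h1, h2⟩
      exact hpq x (h1 (by linarith [dist_triangle x d c]))
        (h2 (by linarith [dist_nonneg (x := d) (y := c)]))
    exact (Metric.measure_ball_pos volume d (by linarith)).ne' hb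
  have hprop : ∀ v : ℝ≥0∞, (v = 0 ∨ v = ∞) → ∀ c, (∀ᵐ x ∂arcMeasure c ℓ, w x = v) →
      ∀ d, ∀ᵐ x ∂arcMeasure d ℓ, w x = v := by
    intro v hv c hc
    have hstep : ∀ c d, dist d c < ℓ / 2 → (∀ᵐ x ∂arcMeasure c ℓ, w x = v) →
        ∀ᵐ x ∂arcMeasure d ℓ, w x = v := by
      intro c d hcd hc
      have k1 := hoverlap (fun x => w x = v) (fun x => w x ≠ 0 ∧ w x ≠ ∞)
        (by rintro x rfl ⟨h1, h2⟩; exact hv.elim h1 h2) c d hcd hc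
      rcases hv with rfl | rfl
      · have k2 := hoverlap (fun x => w x = 0) (fun x => w x = ∞)
          (fun x h1 h2 => by simp [h1] at h2) c d hcd hc
        exact ((htri d).resolve_left k1).resolve_right k2
      · have k2 := hoverlap (fun x => w x = ∞) (fun x => w x = 0)
          (fun x h1 h2 => by simp [h1] at h2) c d hcd hc
        exact ((htri d).resolve_left k1).resolve_left k2
    have hclopen : IsClopen {c | ∀ᵐ x ∂arcMeasure c ℓ, w x = v} := by
      constructor
      · rw [← isOpen_compl_iff, Metric.isOpen_iff]
        intro c hc
        refine ⟨ℓ / 2, by linarith, fun d hd hd' => hc (hstep d c ?_ hd')⟩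
        rw [dist_comm]; exact hd
      · rw [Metric.isOpen_iff]
        exact fun c hc => ⟨ℓ / 2, by linarith, fun d hd => hstep c d hd hc⟩
    have := hclopen.eq_univ ⟨c, hc⟩
    exact fun d => (this ▸ Set.mem_univ d : d ∈ {c | ∀ᵐ x ∂arcMeasure c ℓ, w x = v})
  by_cases hz : ∃ c, ∀ᵐ x ∂arcMeasure c ℓ, w x = 0
  · obtain ⟨c, hc⟩ := hz
    exact Or.inr (Or.inl (ae_of_forall_ae_arc h0 h1 (hprop 0 (Or.inl rfl) c hc)))
  by_cases ht : ∃ c, ∀ᵐ x ∂arcMeasure c ℓ, w x = ∞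
  · obtain ⟨c, hc⟩ := ht
    exact Or.inr (Or.inr (ae_of_forall_ae_arc h0 h1 (hprop ∞ (Or.inr rfl) c hc)))
  · refine Or.inl (ae_of_forall_ae_arc h0 h1 fun c => (htri c).resolve_right ?_)
    exact not_or.2 ⟨fun h => hz ⟨c, h⟩, fun h => ht ⟨c, h⟩⟩

/-! ### The Poisson kernel -/

/-- The length of a chord in terms of the angle it subtends. -/
theorem norm_toCircle_sub (θ c : UnitAddCircle) : ∃ y : ℝ, |y| = ‖θ - c‖ ∧
    ‖(AddCircle.toCircle θ : ℂ) - (AddCircle.toCircle c : ℂ)‖ = 2 * |Real.sin (Real.pi * y)| := by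
  obtain ⟨y, hy, hn⟩ := exists_real_rep (θ - c)
  refine ⟨y, hn, ?_⟩
  have h1 : AddCircle.toCircle θ =
      AddCircle.toCircle c * AddCircle.toCircle (y : UnitAddCircle) := by
    rw [← AddCircle.toCircle_add, hy]; congr 1; abel
  have h2 : (AddCircle.toCircle θ : ℂ) - (AddCircle.toCircle c : ℂ) =
      (AddCircle.toCircle c : ℂ) * (Complex.exp (Complex.I * ((2 * Real.pi * y : ℝ) : ℂ)) - 1) := by
    rw [h1, AddCircle.toCircle_apply_mk, Circle.coe_mul, Circle.coe_exp, mul_sub, mul_one, div_one,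
      mul_comm Complex.I]
  rw [h2, norm_mul, Circle.norm_coe, one_mul, Complex.norm_exp_I_mul_ofReal_sub_one, norm_mul]
  simp only [Real.norm_eq_abs, Nat.abs_ofNat]
  congr 3
  ring

theorem four_mul_norm_le_norm_toCircle_sub (θ c : UnitAddCircle) :
    4 * ‖θ - c‖ ≤ ‖(AddCircle.toCircle θ : ℂ) - (AddCircle.toCircle c : ℂ)‖ := by
  obtain ⟨y, hy, h⟩ := norm_toCircle_sub θ c
  have hhalf : |y| ≤ 1 / 2 := by
    rw [hy]; simpa using AddCircle.norm_le_half_period (1 : ℝ) (x := θ - c) one_ne_zero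
  have := Real.mul_abs_le_abs_sin (x := Real.pi * y) (by
    rw [abs_mul, abs_of_pos Real.pi_pos]; nlinarith [Real.pi_pos])
  rw [abs_mul, abs_of_pos Real.pi_pos, ← mul_assoc, div_mul_cancel₀ _ Real.pi_ne_zero] at this
  rw [h, ← hy]
  linarith

theorem norm_toCircle_sub_le (θ c : UnitAddCircle) :
    ‖(AddCircle.toCircle θ : ℂ) - (AddCircle.toCircle c : ℂ)‖ ≤ 8 * ‖θ - c‖ := by
  obtain ⟨y, hy, h⟩ := norm_toCircle_sub θ c
  have := Real.abs_sin_le_abs (x := Real.pi * y)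
  rw [abs_mul, abs_of_pos Real.pi_pos] at this
  rw [h, ← hy]
  nlinarith [Real.pi_lt_four, abs_nonneg y]

theorem exists_eq_mul_toCircle (lam : ℂ) :
    ∃ c : UnitAddCircle, lam = (‖lam‖ : ℂ) * (AddCircle.toCircle c : ℂ) := by
  refine ⟨((lam.arg / (2 * Real.pi) : ℝ) : UnitAddCircle), ?_⟩
  rw [AddCircle.toCircle_apply_mk, Circle.coe_exp, div_one,
    mul_div_cancel₀ _ (by positivity), Complex.norm_mul_exp_arg_mul_I]

theorem poissonKernel_toCircle (lam : ℂ) (θ : UnitAddCircle) :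
    poissonKernel 0 lam (AddCircle.toCircle θ : ℂ) =
      (1 - ‖lam‖ ^ 2) / ‖(AddCircle.toCircle θ : ℂ) - lam‖ ^ 2 := by
  rw [poissonKernel_def, sub_zero, sub_zero, Circle.norm_coe, one_pow]

theorem one_sub_norm_le_norm_toCircle_sub (lam : ℂ) (θ : UnitAddCircle) :
    1 - ‖lam‖ ≤ ‖(AddCircle.toCircle θ : ℂ) - lam‖ := by
  have := norm_sub_norm_le (AddCircle.toCircle θ : ℂ) lam
  rwa [Circle.norm_coe] at this

theorem norm_mul_toCircle_sub (lam : ℂ) (c : UnitAddCircle) (h1 : ‖lam‖ < 1)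
    (hc : lam = (‖lam‖ : ℂ) * (AddCircle.toCircle c : ℂ)) :
    ‖(AddCircle.toCircle c : ℂ) - lam‖ = 1 - ‖lam‖ := by
  have : (AddCircle.toCircle c : ℂ) - lam =
      ((1 - ‖lam‖ : ℝ) : ℂ) * (AddCircle.toCircle c : ℂ) := by
    nth_rewrite 1 [hc]
    push_cast; ring
  rw [this, norm_mul, Circle.norm_coe, mul_one, Complex.norm_real, Real.norm_eq_abs,
    abs_of_pos (by linarith)]

theorem poissonKernel_pos {lam : ℂ} (h1 : ‖lam‖ < 1) (θ : UnitAddCircle) :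
    0 < poissonKernel 0 lam (AddCircle.toCircle θ : ℂ) := by
  rw [poissonKernel_toCircle]
  have := one_sub_norm_le_norm_toCircle_sub lam θ
  have h0 := norm_nonneg lam
  refine div_pos (by nlinarith) (pow_pos (by linarith) 2)

theorem poissonKernel_le {lam : ℂ} (h1 : ‖lam‖ < 1) (θ : UnitAddCircle) :
    poissonKernel 0 lam (AddCircle.toCircle θ : ℂ) ≤ 2 / (1 - ‖lam‖) := by
  rw [poissonKernel_toCircle]
  have h := one_sub_norm_le_norm_toCircle_sub lam θ
  have h0 := norm_nonneg lam
  have hp : 0 < 1 - ‖lam‖ := by linarith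
  rw [div_le_div_iff₀ (pow_pos (by linarith) 2) hp]
  have h2 : (1 - ‖lam‖) ^ 2 ≤ ‖(AddCircle.toCircle θ : ℂ) - lam‖ ^ 2 := by gcongr
  nlinarith

theorem poissonKernel_le_of_notMem_arc {lam : ℂ} (h1 : ‖lam‖ < 1) {c : UnitAddCircle}
    (hc : lam = (‖lam‖ : ℂ) * (AddCircle.toCircle c : ℂ)) {ℓ : ℝ} (h0 : 0 < ℓ) {θ : UnitAddCircle}
    (hθ : θ ∉ arc c ℓ) :
    poissonKernel 0 lam (AddCircle.toCircle θ : ℂ) ≤ 2 * (1 - ‖lam‖) / ℓ ^ 2 := by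
  rw [poissonKernel_toCircle]
  have h := one_sub_norm_le_norm_toCircle_sub lam θ
  have hc' := norm_mul_toCircle_sub lam c h1 hc
  have h4 := four_mul_norm_le_norm_toCircle_sub θ c
  have ht := norm_sub_le_norm_sub_add_norm_sub (AddCircle.toCircle θ : ℂ) lam
    (AddCircle.toCircle c : ℂ)
  rw [norm_sub_rev lam, hc'] at ht
  simp only [arc, Metric.mem_closedBall, dist_eq_norm, not_le] at hθ
  have h5 : ℓ ≤ ‖(AddCircle.toCircle θ : ℂ) - lam‖ := by linarith
  have hn := norm_nonneg lam
  refine div_le_div₀ (by nlinarith) (by nlinarith) (by positivity) (by gcongr)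

theorem le_poissonKernel_of_mem_arc {lam : ℂ} (h1 : ‖lam‖ < 1) {c : UnitAddCircle}
    (hc : lam = (‖lam‖ : ℂ) * (AddCircle.toCircle c : ℂ)) {θ : UnitAddCircle}
    (hθ : θ ∈ arc c (1 - ‖lam‖)) :
    1 / (25 * (1 - ‖lam‖)) ≤ poissonKernel 0 lam (AddCircle.toCircle θ : ℂ) := by
  rw [poissonKernel_toCircle]
  have h := one_sub_norm_le_norm_toCircle_sub lam θ
  have hc' := norm_mul_toCircle_sub lam c h1 hc
  have h8 := norm_toCircle_sub_le θ c
  have ht := norm_sub_le_norm_sub_add_norm_sub (AddCircle.toCircle θ : ℂ)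
    (AddCircle.toCircle c : ℂ) lam
  rw [hc'] at ht
  simp only [arc, Metric.mem_closedBall, dist_eq_norm] at hθ
  have hp : 0 < 1 - ‖lam‖ := by linarith
  have h5 : ‖(AddCircle.toCircle θ : ℂ) - lam‖ ≤ 5 * (1 - ‖lam‖) := by linarith
  have h6 : ‖(AddCircle.toCircle θ : ℂ) - lam‖ ^ 2 ≤ (5 * (1 - ‖lam‖)) ^ 2 := by gcongr
  have hn := norm_nonneg lam
  rw [div_le_div_iff₀ (by positivity) (pow_pos (by linarith) 2)]
  nlinarith [mul_nonneg hn (sq_nonneg (1 - ‖lam‖))]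

/-- The Poisson (harmonic) measure on the circle at the point `lam` of the disk. -/
noncomputable def poissonMeasure (lam : ℂ) : Measure UnitAddCircle :=
  volume.withDensity fun θ => ENNReal.ofReal (poissonKernel 0 lam (AddCircle.toCircle θ : ℂ))

theorem measurable_poissonKernel_toCircle (lam : ℂ) :
    Measurable fun θ : UnitAddCircle => poissonKernel 0 lam (AddCircle.toCircle θ : ℂ) := by
  simp_rw [poissonKernel_toCircle]
  have : Measurable fun θ : UnitAddCircle => (AddCircle.toCircle θ : ℂ) :=
    (continuous_subtype_val.comp AddCircle.continuous_toCircle).measurable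
  fun_prop

theorem lintegral_poissonMeasure (f : UnitAddCircle → ℝ≥0∞) (lam : ℂ) :
    ∫⁻ θ, f θ ∂poissonMeasure lam = harmonicExtension f lam :=
  lintegral_withDensity_eq_lintegral_mul_non_measurable _
    (measurable_poissonKernel_toCircle lam).ennreal_ofReal
    (Eventually.of_forall fun _ => ENNReal.ofReal_lt_top) f

theorem poissonMeasure_absolutelyContinuous (lam : ℂ) : poissonMeasure lam ≪ volume :=
  withDensity_absolutelyContinuous _ _

theorem absolutelyContinuous_poissonMeasure {lam : ℂ} (h1 : ‖lam‖ < 1) :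
    volume ≪ poissonMeasure lam := by
  refine withDensity_absolutelyContinuous'
    (measurable_poissonKernel_toCircle lam).ennreal_ofReal.aemeasurable
    (Eventually.of_forall fun θ => ?_)
  simpa using poissonKernel_pos h1 θ

/-- The Poisson formula for the constant function `1`. -/
theorem isProbabilityMeasure_poissonMeasure {lam : ℂ} (h1 : ‖lam‖ < 1) :
    IsProbabilityMeasure (poissonMeasure lam) := by
  have hcirc := DiffContOnCl.circleAverage_poissonKernel_smul (E := ℂ) (f := fun _ => 1) (c := 0)
    (R := 1) (w := lam) diffContOnCl_const (by simpa using h1)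
  have hint : ∫ θ : UnitAddCircle, poissonKernel 0 lam (AddCircle.toCircle θ : ℂ) = 1 := by
    rw [← UnitAddCircle.intervalIntegral_preimage 0]
    rw [Real.circleAverage_def] at hcirc
    have hsub := intervalIntegral.mul_integral_comp_mul_left (a := 0) (b := 1)
      (f := fun t => poissonKernel 0 lam (circleMap 0 1 t)) (2 * Real.pi)
    simp only [mul_zero, mul_one] at hsub
    have hre : ((2 * Real.pi)⁻¹ * ∫ t in (0 : ℝ)..2 * Real.pi,
        poissonKernel 0 lam (circleMap 0 1 t) : ℝ) = 1 := by
      have : ∀ t, (poissonKernel 0 lam • fun _ : ℂ => (1 : ℂ)) (circleMap 0 1 t) =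
          ((poissonKernel 0 lam (circleMap 0 1 t) : ℝ) : ℂ) := fun t => by simp
      simp_rw [this] at hcirc
      rw [intervalIntegral.integral_ofReal, Complex.real_smul] at hcirc
      exact_mod_cast hcirc
    rw [← hsub, inv_mul_cancel_left₀ (by positivity)] at hre
    rw [zero_add]
    refine Eq.trans ?_ hre
    refine intervalIntegral.integral_congr fun x _ => ?_
    simp only [AddCircle.toCircle_apply_mk, Circle.coe_exp, circleMap, div_one]
    simp
  have hI : Integrable fun θ : UnitAddCircle =>
      poissonKernel 0 lam (AddCircle.toCircle θ : ℂ) := by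
    by_contra hni
    rw [integral_undef hni] at hint
    exact zero_ne_one hint
  refine ⟨?_⟩
  rw [poissonMeasure, withDensity_apply _ MeasurableSet.univ, setLIntegral_univ,
    ← ofReal_integral_eq_lintegral_ofReal hI
      (Eventually.of_forall fun θ => (poissonKernel_pos h1 θ).le), hint, ENNReal.ofReal_one]

/-- Averages over the arc of length `1 - ‖lam‖` centred at `lam / ‖lam‖` are dominated by the
Poisson measure at `lam`. -/
theorem arcMeasure_le_poissonMeasure {lam : ℂ} (h1 : ‖lam‖ < 1) {c : UnitAddCircle}
    (hc : lam = (‖lam‖ : ℂ) * (AddCircle.toCircle c : ℂ)) :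
    arcMeasure c (1 - ‖lam‖) ≤ (25 : ℝ≥0∞) • poissonMeasure lam := by
  have hp : 0 < 1 - ‖lam‖ := by linarith
  have hn := norm_nonneg lam
  rw [arcMeasure_eq c (by linarith), poissonMeasure, ← withDensity_smul _
    (measurable_poissonKernel_toCircle lam).ennreal_ofReal, ← withDensity_const,
    ← withDensity_indicator (measurableSet_arc _ _)]
  refine withDensity_mono (Eventually.of_forall fun θ => ?_)
  by_cases hθ : θ ∈ arc c (1 - ‖lam‖)
  · simp only [Set.indicator_of_mem hθ, Pi.smul_apply, smul_eq_mul]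
    rw [← ENNReal.ofReal_inv_of_pos hp, ← ENNReal.ofReal_ofNat 25,
      ← ENNReal.ofReal_mul (by norm_num)]
    refine ENNReal.ofReal_le_ofReal ?_
    have := le_poissonKernel_of_mem_arc h1 hc hθ
    calc (1 - ‖lam‖)⁻¹ = 25 * (1 / (25 * (1 - ‖lam‖))) := by field_simp
      _ ≤ _ := by gcongr
  · simp [Set.indicator_of_notMem hθ]

theorem eventually_toBoundary {p : ℂ → Prop} :
    (∀ᶠ lam in toBoundary, p lam) ↔
      ∃ h₀ ∈ Set.Ioc (0 : ℝ) 1, ∀ lam : ℂ, 1 - ‖lam‖ ∈ Set.Ioc 0 h₀ → p lam := by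
  rw [toBoundary, eventually_comap]
  constructor
  · intro h
    obtain ⟨u, hu, hu'⟩ := mem_nhdsLT_iff_exists_Ico_subset.1 h
    have hu1 : u < 1 := hu
    refine ⟨min (1 - u) 1, ⟨lt_min (by linarith) one_pos, min_le_right _ _⟩, fun lam hlam => ?_⟩
    have := hlam.2.trans (min_le_left _ _)
    exact hu' ⟨by linarith, by linarith [hlam.1]⟩ lam rfl
  · rintro ⟨h₀, h0, h⟩
    filter_upwards [Ico_mem_nhdsLT (show 1 - h₀ < 1 by linarith [h0.1])] with r hr lam hlam
    exact h lam ⟨by rw [hlam]; linarith [hr.2], by rw [hlam]; linarith [hr.1]⟩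

instance : toBoundary.NeBot := by
  refine comap_neBot fun t ht => ?_
  obtain ⟨u, hu, hu'⟩ := mem_nhdsLT_iff_exists_Ico_subset.1 ht
  have hu1 : u < 1 := hu
  refine ⟨((max u 0 : ℝ) : ℂ), hu' ?_⟩
  rw [Complex.norm_real, Real.norm_eq_abs, abs_of_nonneg (le_max_right _ _)]
  exact ⟨le_max_left _ _, max_lt hu1 one_pos⟩

/-! ### Poisson means of the exponential of the oscillation -/

/-- The Poisson measure at height `1 - ‖lam‖ ∈ [s / 2, s]` is dominated, on an arc of length
`2 ^ K * s`, by a geometrically decaying combination of the averages over arcs of length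
`2 ^ i * s`. -/
theorem setLIntegral_poissonKernel_le {lam : ℂ} (h1 : ‖lam‖ < 1) {c : UnitAddCircle}
    (hc : lam = (‖lam‖ : ℂ) * (AddCircle.toCircle c : ℂ)) {s : ℝ} (hs0 : 0 < s)
    (hs1 : s / 2 ≤ 1 - ‖lam‖) (hs2 : 1 - ‖lam‖ ≤ s) (G : UnitAddCircle → ℝ≥0∞) (K : ℕ)
    (hK : s * 2 ^ K ≤ 1) :
    ∫⁻ θ in arc c (s * 2 ^ K),
        ENNReal.ofReal (poissonKernel 0 lam (AddCircle.toCircle θ : ℂ)) * G θ ≤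
      ∑ i ∈ Finset.range (K + 1),
        ENNReal.ofReal (8 / 2 ^ i) * ∫⁻ θ, G θ ∂arcMeasure c (s * 2 ^ i) := by
  have hp : 0 < 1 - ‖lam‖ := by linarith
  have step : ∀ (ℓ A : ℝ) (S : Set UnitAddCircle), 0 < ℓ → ℓ ≤ 1 → 0 ≤ A → MeasurableSet S →
      S ⊆ arc c ℓ → (∀ θ ∈ S, poissonKernel 0 lam (AddCircle.toCircle θ : ℂ) ≤ A / ℓ) →
      ∫⁻ θ in S, ENNReal.ofReal (poissonKernel 0 lam (AddCircle.toCircle θ : ℂ)) * G θ ≤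
        ENNReal.ofReal A * ∫⁻ θ, G θ ∂arcMeasure c ℓ := by
    intro ℓ A S h0 h1 hA hS hSa hP
    calc ∫⁻ θ in S, ENNReal.ofReal (poissonKernel 0 lam (AddCircle.toCircle θ : ℂ)) * G θ
        ≤ ∫⁻ θ in S, ENNReal.ofReal (A / ℓ) * G θ := by
          refine setLIntegral_mono' hS fun θ hθ => ?_
          gcongr
          exact hP θ hθ
      _ ≤ ∫⁻ θ in arc c ℓ, ENNReal.ofReal (A / ℓ) * G θ := lintegral_mono_set hSa
      _ = _ := by
          rw [lintegral_const_mul' _ _ ENNReal.ofReal_ne_top, restrict_arc_eq_smul c h0 h1,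
            lintegral_smul_measure, smul_eq_mul, ← mul_assoc,
            ← ENNReal.ofReal_mul (by positivity), div_mul_cancel₀ _ h0.ne']
  -- the innermost arc uses `P ≤ 2 / (1 - ‖lam‖)`, each dyadic annulus the decay of `P`
  induction K with
  | zero =>
    simp only [pow_zero, mul_one] at hK ⊢
    simp only [zero_add, Finset.range_one, Finset.sum_singleton, pow_zero, mul_one, div_one]
    refine step s 8 _ hs0 hK (by norm_num) (measurableSet_arc _ _) subset_rfl fun θ _ => ?_
    refine (poissonKernel_le h1 θ).trans ?_
    rw [div_le_div_iff₀ hp hs0]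
    linarith
  | succ K ih =>
    have hK' : s * 2 ^ K ≤ 1 := by
      refine le_trans ?_ hK
      rw [pow_succ]
      have : 0 < s * 2 ^ K := by positivity
      linarith
    have hsub : arc c (s * 2 ^ (K + 1)) ⊆
        arc c (s * 2 ^ K) ∪ (arc c (s * 2 ^ (K + 1)) \ arc c (s * 2 ^ K)) := by
      rw [Set.union_sdiff_self]; exact Set.subset_union_right
    rw [Finset.sum_range_succ]
    refine (lintegral_mono_set hsub).trans ((lintegral_union_le _ _ _).trans
      (add_le_add (ih hK') ?_))
    refine step _ _ _ (by positivity) hK (by positivity)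
      ((measurableSet_arc _ _).diff (measurableSet_arc _ _)) Set.sdiff_subset fun θ hθ => ?_
    refine (poissonKernel_le_of_notMem_arc h1 hc (by positivity) hθ.2).trans ?_
    rw [div_div, div_le_div_iff₀ (by positivity) (by positivity)]
    have : 2 * (1 - ‖lam‖) * (2 ^ (K + 1) * (s * 2 ^ (K + 1))) =
      8 * (s * (2 ^ K) ^ 2) * (1 - ‖lam‖) := by ring
    rw [this]
    have : 8 * (s * 2 ^ K) ^ 2 = 8 * (s * (2 ^ K) ^ 2) * s := by ring
    rw [this]
    gcongr

/-- Averages over concentric arcs of dyadic lengths differ by at most a multiple of the number of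
doublings. -/
theorem abs_average_sub_average_le {φ : UnitAddCircle → ℝ} (hφ : Integrable φ) {δ ℓ₀ : ℝ}
    (hℓ₀ : ℓ₀ ≤ 1) (hosc : ∀ c, ∀ ℓ ∈ Set.Ioc 0 ℓ₀, meanOscillation φ c ℓ ≤ δ)
    (c : UnitAddCircle) {s : ℝ} (hs : 0 < s) (i : ℕ) (hi : s * 2 ^ i ≤ ℓ₀) :
    |∫ x, φ x ∂arcMeasure c (s * 2 ^ i) - ∫ x, φ x ∂arcMeasure c s| ≤ 2 * δ * i := by
  induction i with
  | zero => simp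
  | succ i ih =>
    set ℓ := s * 2 ^ (i + 1) with hℓ
    have hℓ' : s * 2 ^ i = ℓ / 2 := by rw [hℓ, pow_succ]; ring
    have h0 : 0 < ℓ := by positivity
    have hi' : s * 2 ^ i ≤ ℓ₀ := by rw [hℓ']; linarith
    have h1 : ℓ ≤ 1 := hi.trans hℓ₀
    have ih' := ih hi'
    rw [hℓ'] at ih'
    have hp := isProbabilityMeasure_arcMeasure c (half_pos h0) (by linarith)
    set b := ∫ x, φ x ∂arcMeasure c ℓ with hb
    have hstep : |∫ x, φ x ∂arcMeasure c (ℓ / 2) - b| ≤ 2 * δ := by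
      refine (abs_integral_sub_le (integrable_arcMeasure hφ c (half_pos h0) (by linarith)) b).trans
        ?_
      have hI : Integrable (fun x => |φ x - b|) ((2 : ℝ≥0∞) • arcMeasure c ℓ) :=
        (integrable_arcMeasure (hφ.sub (integrable_const b)).abs c h0 h1).smul_measure (by simp)
      refine (integral_mono_measure (arcMeasure_half_le c h0 h1)
        (Eventually.of_forall fun x => abs_nonneg _) hI).trans ?_
      rw [integral_smul_measure, ENNReal.toReal_ofNat, smul_eq_mul]
      have : ∫ x, |φ x - b| ∂arcMeasure c ℓ ≤ δ := hosc c ℓ ⟨h0, hi⟩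
      linarith
    have htri := abs_sub_le b (∫ x, φ x ∂arcMeasure c (ℓ / 2)) (∫ x, φ x ∂arcMeasure c s)
    rw [abs_sub_comm b (∫ x, φ x ∂arcMeasure c (ℓ / 2))] at htri
    push_cast
    linarith

/-- The left side bounds the mean of `exp |φ - a|` over an arc `2 ^ i` times as long as the one over
which `a` is the average; its excess over `1` is summable against the Poisson weights `2 ^ (-i)`. -/
theorem exp_growth_le {δ : ℝ} (h0 : 0 ≤ δ) (h1 : δ ≤ 1 / 16) (i : ℕ) :
    Real.exp (2 * δ * i) * (1 + 20 * δ) ≤ 1 + 28 * δ * (3 / 2) ^ i := by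
  have hq : Real.exp (2 * δ) ≤ 1 + 4 * δ := by
    have := Real.exp_bound_div_one_sub_of_interval (x := 2 * δ) (by linarith) (by linarith)
    refine this.trans ?_
    rw [div_le_iff₀ (by linarith)]
    nlinarith
  have hpow : Real.exp (2 * δ * i) ≤ (1 + 4 * δ) ^ i := by
    rw [mul_comm, Real.exp_nat_mul]
    gcongr
  -- convexity of `q ↦ q ^ i` between `1` and `3 / 2`
  have h2 : ∀ j : ℕ, (1 + 4 * δ) ^ j ≤ 1 + 8 * δ * ((3 / 2) ^ j - 1) := by
    intro j
    induction j with
    | zero => simp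
    | succ j ih =>
      have hj : (1 : ℝ) ≤ (3 / 2) ^ j := one_le_pow₀ (by norm_num)
      rw [pow_succ, pow_succ]
      have := mul_le_mul_of_nonneg_right ih (by linarith : 0 ≤ 1 + 4 * δ)
      nlinarith [mul_nonneg h0 (sub_nonneg.2 hj)]
  have h3 : (1 + 4 * δ) ^ i ≤ (3 / 2) ^ i := by gcongr; linarith
  have h4 := h2 i
  nlinarith [mul_le_mul_of_nonneg_right hpow (by linarith : 0 ≤ 1 + 20 * δ),
    mul_le_mul_of_nonneg_left h3 h0]

/-- By the John–Nirenberg inequality `exp |φ|` is integrable on short arcs, hence on the circle. -/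
theorem lintegral_exp_abs_lt_top {φ : UnitAddCircle → ℝ} (hφ : Integrable φ) {δ ℓ₀ : ℝ}
    (h0 : 0 < ℓ₀) (hℓ₀ : ℓ₀ ≤ 1) (hδ : 0 ≤ δ) (hδ' : δ ≤ 1 / 16)
    (hosc : ∀ c, ∀ ℓ ∈ Set.Ioc 0 ℓ₀, meanOscillation φ c ℓ ≤ δ) :
    ∫⁻ x, ENNReal.ofReal (Real.exp |φ x|) < ∞ := by
  have hI : Integrable fun x => Real.exp |φ x| := by
    refine integrable_of_forall_arc h0 hℓ₀ fun c => ⟨?_, ?_⟩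
    · exact (Real.continuous_exp.comp continuous_abs).comp_aestronglyMeasurable
        (integrable_arcMeasure hφ c h0 hℓ₀).aestronglyMeasurable
    · rw [hasFiniteIntegral_iff_ofReal (Eventually.of_forall fun x => Real.exp_nonneg _)]
      have hJN := lintegral_exp_sub_average_le hφ hℓ₀ hδ hδ' hosc c ⟨h0, le_rfl⟩
      set a := ∫ x, φ x ∂arcMeasure c ℓ₀
      calc ∫⁻ x, ENNReal.ofReal (Real.exp |φ x|) ∂arcMeasure c ℓ₀
          ≤ ∫⁻ x, ENNReal.ofReal (Real.exp |a|) * ENNReal.ofReal (Real.exp |φ x - a|)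
              ∂arcMeasure c ℓ₀ := by
            refine lintegral_mono fun x => ?_
            rw [← ENNReal.ofReal_mul (Real.exp_nonneg _), ← Real.exp_add]
            refine ENNReal.ofReal_le_ofReal (Real.exp_le_exp.2 ?_)
            linarith [abs_sub_abs_le_abs_sub (φ x) a]
        _ < ∞ := by
            rw [lintegral_const_mul' _ _ ENNReal.ofReal_ne_top]
            exact ENNReal.mul_lt_top ENNReal.ofReal_lt_top (hJN.trans_lt ENNReal.ofReal_lt_top)
  exact (hasFiniteIntegral_iff_ofReal (Eventually.of_forall fun x => Real.exp_nonneg _)).1 hI.2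

theorem sum_three_quarters_pow_le (n : ℕ) : ∑ i ∈ Finset.range n, (3 / 4 : ℝ) ^ i ≤ 4 := by
  rw [geom_sum_eq (by norm_num)]
  have : (0 : ℝ) ≤ (3 / 4) ^ n := by positivity
  rw [div_le_iff_of_neg (by norm_num)]
  linarith

theorem lintegral_exp_abs_eq {α : Type*} [MeasurableSpace α] (μ : Measure α)
    [IsProbabilityMeasure μ] (ψ : α → ℝ) :
    ∫⁻ x, ENNReal.ofReal (Real.exp |ψ x|) ∂μ =
      1 + ∫⁻ x, ENNReal.ofReal (Real.exp |ψ x| - 1) ∂μ := by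
  have hpt : ∀ x, ENNReal.ofReal (Real.exp |ψ x|) =
      1 + ENNReal.ofReal (Real.exp |ψ x| - 1) := fun x => by
    rw [← ENNReal.ofReal_one, ← ENNReal.ofReal_add zero_le_one
      (sub_nonneg.2 (Real.one_le_exp (abs_nonneg _)))]
    congr 1; ring
  simp_rw [hpt]
  rw [lintegral_add_left measurable_const]
  simp

/-- Poisson means of `exp |φ - a|` for `φ` of small mean oscillation on short arcs.  The constant
`a` is the average of `φ` over an arc of length comparable to `1 - ‖lam‖`.  On the arcs of length at
most `ℓ₀` the John–Nirenberg inequality is summed over dyadic lengths; the rest of the circle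
contributes a term that decays geometrically in the number of dyadic lengths. -/
theorem lintegral_exp_poissonMeasure_le {φ : UnitAddCircle → ℝ} (hφ : Integrable φ) {δ ℓ₀ : ℝ}
    (h0 : 0 < ℓ₀) (hℓ₀ : ℓ₀ ≤ 1) (hδ : 0 ≤ δ) (hδ' : δ ≤ 1 / 16)
    (hosc : ∀ c, ∀ ℓ ∈ Set.Ioc 0 ℓ₀, meanOscillation φ c ℓ ≤ δ) {lam : ℂ} (h1 : ‖lam‖ < 1)
    {K : ℕ} (hK : ℓ₀ / 2 ^ K / 2 ≤ 1 - ‖lam‖) (hK' : 1 - ‖lam‖ ≤ ℓ₀ / 2 ^ K) :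
    ∃ a : ℝ, ∫⁻ θ, ENNReal.ofReal (Real.exp |φ θ - a|) ∂poissonMeasure lam ≤
      1 + (ENNReal.ofReal (896 * δ) +
        ENNReal.ofReal (2 / ℓ₀ * Real.exp ((∫ x, |φ x|) / ℓ₀) * (3 / 4) ^ K) *
          ∫⁻ x, ENNReal.ofReal (Real.exp |φ x|)) := by
  obtain ⟨c, hc⟩ := exists_eq_mul_toCircle lam
  set s := ℓ₀ / 2 ^ K with hs
  have hs0 : 0 < s := by positivity
  have hsK : s * 2 ^ K = ℓ₀ := by rw [hs]; field_simp
  have hsi : ∀ i ≤ K, s * 2 ^ i ≤ ℓ₀ := fun i hi => by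
    rw [← hsK]
    gcongr
    norm_num
  set a := ∫ x, φ x ∂arcMeasure c s with ha
  have := isProbabilityMeasure_poissonMeasure h1
  refine ⟨a, ?_⟩
  rw [lintegral_exp_abs_eq, lintegral_poissonMeasure, harmonicExtension,
    ← lintegral_add_compl _ (measurableSet_arc c (s * 2 ^ K))]
  refine add_le_add_right (add_le_add ?_ ?_) _
  · refine (setLIntegral_poissonKernel_le h1 hc hs0 hK hK' _ K (by rw [hsK]; exact hℓ₀)).trans ?_
    have hterm : ∀ i ∈ Finset.range (K + 1), ENNReal.ofReal (8 / 2 ^ i) *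
        ∫⁻ θ, ENNReal.ofReal (Real.exp |φ θ - a| - 1) ∂arcMeasure c (s * 2 ^ i) ≤
          ENNReal.ofReal (224 * δ * (3 / 4) ^ i) := by
      -- `224 = 8 * 28`: Poisson weight times exponential loss; the sum is at most `4 * 224`
      intro i hi
      have hi' := hsi i (Nat.lt_succ_iff.1 (Finset.mem_range.1 hi))
      have hmem : s * 2 ^ i ∈ Set.Ioc 0 ℓ₀ := ⟨by positivity, hi'⟩
      have := isProbabilityMeasure_arcMeasure c hmem.1 (hi'.trans hℓ₀)
      have hJN := lintegral_exp_sub_average_le hφ hℓ₀ hδ hδ' hosc c hmem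
      have hab := abs_average_sub_average_le hφ hℓ₀ hosc c hs0 i hi'
      rw [← ha] at hab
      set b := ∫ x, φ x ∂arcMeasure c (s * 2 ^ i) with hb
      have hexp : ∫⁻ θ, ENNReal.ofReal (Real.exp |φ θ - a|) ∂arcMeasure c (s * 2 ^ i) ≤
          1 + ENNReal.ofReal (28 * δ * (3 / 2) ^ i) := by
        calc ∫⁻ θ, ENNReal.ofReal (Real.exp |φ θ - a|) ∂arcMeasure c (s * 2 ^ i)
            ≤ ∫⁻ θ, ENNReal.ofReal (Real.exp (2 * δ * i)) *
                ENNReal.ofReal (Real.exp |φ θ - b|) ∂arcMeasure c (s * 2 ^ i) := by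
              refine lintegral_mono fun θ => ?_
              rw [← ENNReal.ofReal_mul (Real.exp_nonneg _), ← Real.exp_add]
              refine ENNReal.ofReal_le_ofReal (Real.exp_le_exp.2 ?_)
              linarith [abs_sub_le (φ θ) b a]
          _ ≤ ENNReal.ofReal (Real.exp (2 * δ * i)) * ENNReal.ofReal (1 + 20 * δ) := by
              rw [lintegral_const_mul' _ _ ENNReal.ofReal_ne_top]
              gcongr
          _ ≤ ENNReal.ofReal (1 + 28 * δ * (3 / 2) ^ i) := by
              rw [← ENNReal.ofReal_mul (Real.exp_nonneg _)]
              exact ENNReal.ofReal_le_ofReal (exp_growth_le hδ hδ' i)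
          _ = _ := by
              rw [ENNReal.ofReal_add zero_le_one (by positivity), ENNReal.ofReal_one]
      rw [lintegral_exp_abs_eq] at hexp
      refine (mul_le_mul_right ((ENNReal.add_le_add_iff_left ENNReal.one_ne_top).1 hexp) _).trans
        (le_of_eq ?_)
      rw [← ENNReal.ofReal_mul (by positivity)]
      congr 1
      rw [div_pow, div_pow, show (4 : ℝ) = 2 * 2 by norm_num, mul_pow]
      field_simp
      ring
    refine (Finset.sum_le_sum hterm).trans ?_
    rw [← ENNReal.ofReal_sum_of_nonneg fun i _ => by positivity, ← Finset.mul_sum]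
    refine ENNReal.ofReal_le_ofReal ?_
    nlinarith [sum_three_quarters_pow_le (K + 1)]
  · have hab := abs_average_sub_average_le hφ hℓ₀ hosc c hs0 K hsK.le
    rw [hsK, ← ha] at hab
    have hN : |∫ x, φ x ∂arcMeasure c ℓ₀| ≤ (∫ x, |φ x|) / ℓ₀ :=
      abs_integral_le_integral_abs.trans
        (integral_arcMeasure_le hφ.abs (fun x => abs_nonneg _) c h0 hℓ₀)
    have haK : |a| ≤ (∫ x, |φ x|) / ℓ₀ + 2 * δ * K := by
      have := abs_sub_abs_le_abs_sub a (∫ x, φ x ∂arcMeasure c ℓ₀)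
      rw [abs_sub_comm] at this
      linarith
    have hexpK : Real.exp (2 * δ * K) ≤ (3 / 2) ^ K := by
      have hq : Real.exp (2 * δ) ≤ 3 / 2 := by
        have := Real.exp_bound_div_one_sub_of_interval (x := 2 * δ) (by linarith) (by linarith)
        refine this.trans ?_
        rw [div_le_iff₀ (by linarith)]
        linarith
      rw [mul_comm, Real.exp_nat_mul]
      gcongr
    have hexpa : Real.exp |a| ≤ Real.exp ((∫ x, |φ x|) / ℓ₀) * (3 / 2) ^ K := by
      refine (Real.exp_le_exp.2 haK).trans ?_
      rw [Real.exp_add]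
      gcongr
    have hA : 2 * (1 - ‖lam‖) / ℓ₀ ^ 2 * Real.exp |a| ≤
        2 / ℓ₀ * Real.exp ((∫ x, |φ x|) / ℓ₀) * (3 / 4) ^ K := by
      calc 2 * (1 - ‖lam‖) / ℓ₀ ^ 2 * Real.exp |a|
          ≤ 2 * (ℓ₀ / 2 ^ K) / ℓ₀ ^ 2 * (Real.exp ((∫ x, |φ x|) / ℓ₀) * (3 / 2) ^ K) := by
            gcongr
        _ = _ := by
            rw [div_pow, div_pow, show (4 : ℝ) = 2 * 2 by norm_num, mul_pow]
            field_simp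
    calc ∫⁻ θ in (arc c (s * 2 ^ K))ᶜ,
          ENNReal.ofReal (poissonKernel 0 lam (AddCircle.toCircle θ : ℂ)) *
            ENNReal.ofReal (Real.exp |φ θ - a| - 1)
        ≤ ∫⁻ θ in (arc c (s * 2 ^ K))ᶜ, ENNReal.ofReal (2 * (1 - ‖lam‖) / ℓ₀ ^ 2 * Real.exp |a|) *
            ENNReal.ofReal (Real.exp |φ θ|) := by
          refine setLIntegral_mono' (measurableSet_arc _ _).compl fun θ hθ => ?_
          have hP := poissonKernel_le_of_notMem_arc h1 hc (by positivity) hθ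
          rw [hsK] at hP
          have hP0 := (poissonKernel_pos h1 θ).le
          rw [← ENNReal.ofReal_mul hP0, ← ENNReal.ofReal_mul (by
            have : 0 ≤ 1 - ‖lam‖ := by linarith
            positivity), mul_assoc _ (Real.exp |a|), ← Real.exp_add]
          refine ENNReal.ofReal_le_ofReal (mul_le_mul hP ?_ ?_ (hP0.trans hP))
          · have : Real.exp |φ θ - a| ≤ Real.exp (|a| + |φ θ|) :=
              Real.exp_le_exp.2 (by linarith [abs_sub (φ θ) a])
            linarith
          · exact sub_nonneg.2 (Real.one_le_exp (abs_nonneg _))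
      _ ≤ ∫⁻ θ, ENNReal.ofReal (2 * (1 - ‖lam‖) / ℓ₀ ^ 2 * Real.exp |a|) *
            ENNReal.ofReal (Real.exp |φ θ|) := setLIntegral_le_lintegral _ _
      _ ≤ _ := by
          rw [lintegral_const_mul' _ _ ENNReal.ofReal_ne_top]
          gcongr

theorem IsVMO.exists_meanOscillation_le {φ : UnitAddCircle → ℝ} (hφ : IsVMO φ) {δ : ℝ}
    (hδ : 0 < δ) : ∃ ℓ₀ ∈ Set.Ioc (0 : ℝ) 1, ∀ c, ∀ ℓ ∈ Set.Ioc 0 ℓ₀, meanOscillation φ c ℓ ≤ δ :=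
  eventually_arcsShrinking.1 ((hφ.2.eventually_lt_const hδ).mono fun _ => le_of_lt)

theorem IsVMO.eventually_lintegral_exp_arcMeasure_le {φ : UnitAddCircle → ℝ} (hφ : IsVMO φ)
    {ε : ℝ} (hε : 0 < ε) : ∀ᶠ I in arcsShrinking, ∃ a : ℝ,
      ∫⁻ θ, ENNReal.ofReal (Real.exp |φ θ - a|) ∂arcMeasure I.1 I.2 ≤ ENNReal.ofReal (1 + ε) := by
  set δ := min (1 / 16) (ε / 20) with hδ
  have h1 : δ ≤ 1 / 16 := min_le_left _ _
  have h2 : δ ≤ ε / 20 := min_le_right _ _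
  have h0 : 0 < δ := by positivity
  obtain ⟨ℓ₀, hℓ₀, hosc⟩ := hφ.exists_meanOscillation_le h0
  refine eventually_arcsShrinking.2 ⟨ℓ₀, hℓ₀, fun c ℓ hℓ => ⟨_,
    (lintegral_exp_sub_average_le hφ.1.1 hℓ₀.2 h0.le h1 hosc c hℓ).trans
      (ENNReal.ofReal_le_ofReal (by linarith))⟩⟩

theorem IsVMO.eventually_lintegral_exp_poissonMeasure_le {φ : UnitAddCircle → ℝ} (hφ : IsVMO φ)
    {ε : ℝ} (hε : 0 < ε) : ∀ᶠ lam in toBoundary, ∃ a : ℝ,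
      ∫⁻ θ, ENNReal.ofReal (Real.exp |φ θ - a|) ∂poissonMeasure lam ≤ ENNReal.ofReal (1 + ε) := by
  set δ := min (1 / 16) (ε / 1792) with hδ
  have h1 : δ ≤ 1 / 16 := min_le_left _ _
  have h2 : δ ≤ ε / 1792 := min_le_right _ _
  have h0 : 0 < δ := by positivity
  obtain ⟨ℓ₀, hℓ₀, hosc⟩ := hφ.exists_meanOscillation_le h0
  have hfin := lintegral_exp_abs_lt_top hφ.1.1 hℓ₀.1 hℓ₀.2 h0.le h1 hosc
  set M := (∫⁻ x, ENNReal.ofReal (Real.exp |φ x|)).toReal with hM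
  have hM' : ∫⁻ x, ENNReal.ofReal (Real.exp |φ x|) = ENNReal.ofReal M :=
    (ENNReal.ofReal_toReal hfin.ne).symm
  set C := 2 / ℓ₀ * Real.exp ((∫ x, |φ x|) / ℓ₀) with hC
  have hℓpos := hℓ₀.1
  have hC0 : 0 < C := by positivity
  have hM0 : 0 ≤ M := ENNReal.toReal_nonneg
  have hlim : Tendsto (fun K : ℕ => C * (3 / 4) ^ K * M) atTop (𝓝 0) := by
    have := ((tendsto_pow_atTop_nhds_zero_of_lt_one (r := (3 / 4 : ℝ)) (by norm_num)
      (by norm_num)).const_mul C).mul_const M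
    simpa using this
  obtain ⟨K₀, hK₀⟩ := eventually_atTop.1 (hlim.eventually_lt_const (half_pos hε))
  refine eventually_toBoundary.2 ⟨ℓ₀ / 2 ^ K₀, ⟨by positivity, ?_⟩, fun lam hlam => ?_⟩
  · exact (div_le_self hℓpos.le (one_le_pow₀ (by norm_num))).trans hℓ₀.2
  have hpos : 0 < 1 - ‖lam‖ := hlam.1
  have hle : 2 ^ K₀ ≤ ℓ₀ / (1 - ‖lam‖) := by
    rw [le_div_iff₀ hpos, mul_comm]
    exact (le_div_iff₀ (by positivity)).1 hlam.2
  -- the number of dyadic lengths between `1 - ‖lam‖` and `ℓ₀` tends to infinity at the boundary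
  obtain ⟨K, hKl, hKu⟩ := exists_nat_pow_near ((one_le_pow₀ (by norm_num)).trans hle)
    (one_lt_two : (1 : ℝ) < 2)
  have hKK : K₀ ≤ K :=
    Nat.lt_succ_iff.1 ((pow_lt_pow_iff_right₀ (one_lt_two : (1 : ℝ) < 2)).1 (hle.trans_lt hKu))
  have hb1 : ℓ₀ / 2 ^ K / 2 ≤ 1 - ‖lam‖ := by
    rw [div_div, ← pow_succ, div_le_iff₀ (by positivity), mul_comm]
    exact ((div_lt_iff₀ hpos).1 hKu).le
  have hb2 : 1 - ‖lam‖ ≤ ℓ₀ / 2 ^ K := by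
    rw [le_div_iff₀ (by positivity), mul_comm]
    exact (le_div_iff₀ hpos).1 hKl
  obtain ⟨a, ha⟩ := lintegral_exp_poissonMeasure_le hφ.1.1 hℓpos hℓ₀.2 h0.le h1 hosc
    (by linarith) hb1 hb2
  refine ⟨a, ha.trans ?_⟩
  rw [hM', ← ENNReal.ofReal_mul (by positivity), ← ENNReal.ofReal_add (by positivity)
    (by positivity), ← ENNReal.ofReal_one, ← ENNReal.ofReal_add zero_le_one (by positivity)]
  refine ENNReal.ofReal_le_ofReal ?_
  have := hK₀ K hKK
  linarith

/-! ### Families of probability measures -/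

section Families

variable {ι : Type*} {F : Filter ι} [F.NeBot] {μ : ι → Measure UnitAddCircle}
  {w : UnitAddCircle → ℝ≥0∞}

/-- A limit superior equal to `1` excludes the degenerate weights `0` and `∞`, for which the
product of the means is `0`. -/
theorem ae_ne_zero_ne_top_of_limsup_eq_one (hμ : ∀ᶠ i in F, μ i ≪ volume)
    (h : limsup (fun i => (∫⁻ x, w x ∂μ i) * ∫⁻ x, (w x)⁻¹ ∂μ i) F = 1)
    (htri : (∀ᵐ x, w x ≠ 0 ∧ w x ≠ ∞) ∨ (∀ᵐ x, w x = 0) ∨ ∀ᵐ x, w x = ∞) :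
    ∀ᵐ x, w x ≠ 0 ∧ w x ≠ ∞ := by
  refine htri.resolve_right fun h0 => ?_
  have hz : ∀ᶠ i in F, (∫⁻ x, w x ∂μ i) * ∫⁻ x, (w x)⁻¹ ∂μ i = 0 := by
    filter_upwards [hμ] with i hi
    rcases h0 with h0 | h0
    · have : ∫⁻ x, w x ∂μ i = 0 := by
        rw [lintegral_congr_ae (hi.ae_le h0), lintegral_zero]
      rw [this, zero_mul]
    · have h0' : ∀ᵐ x ∂μ i, w x = ∞ := hi.ae_le h0
      have : ∫⁻ x, (w x)⁻¹ ∂μ i = 0 := by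
        rw [lintegral_congr_ae (h0'.mono fun x hx => by rw [hx, ENNReal.inv_top]),
          lintegral_zero]
      rw [this, mul_zero]
  rw [limsup_congr hz, limsup_const] at h
  exact zero_ne_one h

theorem limsup_means_eq_one_iff {φ : UnitAddCircle → ℝ} (hφ : AEMeasurable φ)
    (hw : ∀ᵐ x, w x = ENNReal.ofReal (Real.exp (φ x)))
    (hμ : ∀ᶠ i in F, IsProbabilityMeasure (μ i) ∧ μ i ≪ volume) :
    limsup (fun i => (∫⁻ x, w x ∂μ i) * ∫⁻ x, (w x)⁻¹ ∂μ i) F = 1 ↔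
      ∀ ε : ℝ, 0 < ε → ∀ᶠ i in F, (∫⁻ x, ENNReal.ofReal (Real.exp (φ x)) ∂μ i) *
        ∫⁻ x, ENNReal.ofReal (Real.exp (-φ x)) ∂μ i ≤ ENNReal.ofReal (1 + ε) := by
  have hcongr : ∀ᶠ i in F, (∫⁻ x, w x ∂μ i) * ∫⁻ x, (w x)⁻¹ ∂μ i =
      (∫⁻ x, ENNReal.ofReal (Real.exp (φ x)) ∂μ i) *
        ∫⁻ x, ENNReal.ofReal (Real.exp (-φ x)) ∂μ i := by
    filter_upwards [hμ] with i hi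
    have hw' : ∀ᵐ x ∂μ i, w x = ENNReal.ofReal (Real.exp (φ x)) := hi.2.ae_le hw
    have hinv : ∀ᵐ x ∂μ i, (w x)⁻¹ = ENNReal.ofReal (Real.exp (-φ x)) :=
      hw'.mono fun x hx => by rw [hx, inv_ofReal_exp]
    rw [lintegral_congr_ae hw', lintegral_congr_ae hinv]
  rw [limsup_congr hcongr]
  refine limsup_eq_one_iff ?_
  filter_upwards [hμ] with i hi
  have := hi.1
  have hm : AEMeasurable φ (μ i) := hφ.mono_ac hi.2
  simp_rw [← inv_ofReal_exp]
  exact one_le_lintegral_mul_lintegral_inv (by fun_prop)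
    (Eventually.of_forall fun x => ⟨by simpa using Real.exp_pos _, ENNReal.ofReal_ne_top⟩)

/-- If every tolerance allows a constant `a` with means of `exp |φ - a|` close to `1`, then the
products of the means of `exp φ` and `exp (-φ)` tend to `1`. -/
theorem limsup_means_eq_one_of_exp {φ : UnitAddCircle → ℝ} (hφ : AEMeasurable φ)
    (hw : ∀ᵐ x, w x = ENNReal.ofReal (Real.exp (φ x)))
    (hμ : ∀ᶠ i in F, IsProbabilityMeasure (μ i) ∧ μ i ≪ volume)
    (h : ∀ ε : ℝ, 0 < ε → ∀ᶠ i in F, ∃ a : ℝ,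
      ∫⁻ θ, ENNReal.ofReal (Real.exp |φ θ - a|) ∂μ i ≤ ENNReal.ofReal (1 + ε)) :
    limsup (fun i => (∫⁻ x, w x ∂μ i) * ∫⁻ x, (w x)⁻¹ ∂μ i) F = 1 := by
  refine (limsup_means_eq_one_iff hφ hw hμ).2 fun ε hε => ?_
  have hm : 0 < min 1 (ε / 3) := by positivity
  filter_upwards [h _ hm] with i ⟨a, ha⟩
  refine (lintegral_exp_mul_lintegral_exp_neg_le hm.le ha).trans (ENNReal.ofReal_le_ofReal ?_)
  nlinarith [min_le_left 1 (ε / 3), min_le_right 1 (ε / 3)]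

/-- The logarithm of the weight, and its mean square deviation from suitable constants. -/
theorem exists_log_of_limsup_eq_one (hwm : AEMeasurable w)
    (hμ : ∀ᶠ i in F, IsProbabilityMeasure (μ i) ∧ μ i ≪ volume)
    (h : limsup (fun i => (∫⁻ x, w x ∂μ i) * ∫⁻ x, (w x)⁻¹ ∂μ i) F = 1)
    (htri : (∀ᵐ x, w x ≠ 0 ∧ w x ≠ ∞) ∨ (∀ᵐ x, w x = 0) ∨ ∀ᵐ x, w x = ∞) :
    ∃ φ : UnitAddCircle → ℝ, AEMeasurable φ ∧ (∀ᵐ x, w x = ENNReal.ofReal (Real.exp (φ x))) ∧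
      ∀ ε : ℝ, 0 < ε → ∀ᶠ i in F, ∃ a : ℝ,
        ∫⁻ x, ENNReal.ofReal ((φ x - a) ^ 2) ∂μ i ≤ ENNReal.ofReal ε := by
  have hpos := ae_ne_zero_ne_top_of_limsup_eq_one (hμ.mono fun _ hi => hi.2) h htri
  have hφ : AEMeasurable fun x => Real.log (w x).toReal :=
    Real.measurable_log.comp_aemeasurable hwm.ennreal_toReal
  have hwφ : ∀ᵐ x, w x = ENNReal.ofReal (Real.exp (Real.log (w x).toReal)) := by
    filter_upwards [hpos] with x hx
    rw [Real.exp_log (ENNReal.toReal_pos hx.1 hx.2), ENNReal.ofReal_toReal hx.2]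
  refine ⟨_, hφ, hwφ, fun ε hε => ?_⟩
  filter_upwards [hμ, (limsup_means_eq_one_iff hφ hwφ hμ).1 h (ε / 2) (half_pos hε)] with i hi hi'
  have := hi.1
  obtain ⟨a, ha⟩ := exists_lintegral_sq_sub_le (hφ.mono_ac hi.2) (half_pos hε).le hi'
  exact ⟨a, by rwa [mul_div_cancel₀ _ (two_ne_zero' ℝ)] at ha⟩

end Families

/-! ### Weights whose logarithm has vanishing mean oscillation -/

theorem eventually_arcMeasure : ∀ᶠ I in arcsShrinking,
    IsProbabilityMeasure (arcMeasure I.1 I.2) ∧ arcMeasure I.1 I.2 ≪ volume :=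
  eventually_arcsShrinking.2 ⟨1, by simp, fun c _ hℓ =>
    ⟨isProbabilityMeasure_arcMeasure c hℓ.1 hℓ.2, arcMeasure_absolutelyContinuous c hℓ.2⟩⟩

theorem eventually_poissonMeasure : ∀ᶠ lam in toBoundary,
    IsProbabilityMeasure (poissonMeasure lam) ∧ poissonMeasure lam ≪ volume :=
  eventually_toBoundary.2 ⟨1, by simp, fun lam hlam =>
    ⟨isProbabilityMeasure_poissonMeasure (by linarith [hlam.1]),
      poissonMeasure_absolutelyContinuous lam⟩⟩

theorem exists_isVMO_of_limsup_arcMeasure {w : UnitAddCircle → ℝ≥0∞} (hw : AEMeasurable w)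
    (h : limsup (fun I : UnitAddCircle × ℝ => (∫⁻ x, w x ∂arcMeasure I.1 I.2) *
      ∫⁻ x, (w x)⁻¹ ∂arcMeasure I.1 I.2) arcsShrinking = 1) :
    ∃ φ : UnitAddCircle → ℝ, IsVMO φ ∧ ∀ᵐ θ, w θ = ENNReal.ofReal (Real.exp (φ θ)) := by
  obtain ⟨ℓ₁, hℓ₁, hfin⟩ := eventually_arcsShrinking.1
    (eventually_lt_of_limsup_lt (h.trans_lt ENNReal.one_lt_top))
  obtain ⟨φ, hφ, hwφ, hsq⟩ := exists_log_of_limsup_eq_one hw eventually_arcMeasure h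
    (ae_trichotomy_of_arcs hw hℓ₁.1 hℓ₁.2 fun c => (hfin c ℓ₁ ⟨hℓ₁.1, le_rfl⟩).ne)
  exact ⟨φ, isVMO_of_lintegral_sq_sub_le hφ fun ε hε => eventually_arcsShrinking.1 (hsq ε hε), hwφ⟩

theorem exists_isVMO_of_limsup_poissonMeasure {w : UnitAddCircle → ℝ≥0∞} (hw : AEMeasurable w)
    (h : limsup (fun lam : ℂ => (∫⁻ x, w x ∂poissonMeasure lam) *
      ∫⁻ x, (w x)⁻¹ ∂poissonMeasure lam) toBoundary = 1) :
    ∃ φ : UnitAddCircle → ℝ, IsVMO φ ∧ ∀ᵐ θ, w θ = ENNReal.ofReal (Real.exp (φ θ)) := by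
  have hcircle : ∀ (c : UnitAddCircle) {ℓ : ℝ}, ℓ ∈ Set.Ioc (0 : ℝ) 1 →
      ‖((1 - ℓ : ℝ) : ℂ) * (AddCircle.toCircle c : ℂ)‖ = 1 - ℓ := fun c ℓ hℓ => by
    rw [norm_mul, Circle.norm_coe, mul_one, Complex.norm_real, Real.norm_eq_abs,
      abs_of_nonneg (by linarith [hℓ.2])]
  have htri : (∀ᵐ x, w x ≠ 0 ∧ w x ≠ ∞) ∨ (∀ᵐ x, w x = 0) ∨ ∀ᵐ x, w x = ∞ := by
    obtain ⟨h₁, hh₁, hfin⟩ := eventually_toBoundary.1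
      (eventually_lt_of_limsup_lt (h.trans_lt ENNReal.one_lt_top))
    have hn := hcircle 0 hh₁
    have hac := absolutelyContinuous_poissonMeasure (hn.trans_lt (by linarith [hh₁.1]))
    have := ae_trichotomy (hw.mono_ac (poissonMeasure_absolutelyContinuous _))
      (hfin _ (by rw [hn]; exact ⟨by linarith [hh₁.1], by linarith⟩)).ne
    exact this.imp (fun h => hac.ae_le h) (Or.imp (fun h => hac.ae_le h) fun h => hac.ae_le h)
  obtain ⟨φ, hφ, hwφ, hsq⟩ := exists_log_of_limsup_eq_one hw eventually_poissonMeasure h htri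
  refine ⟨φ, isVMO_of_lintegral_sq_sub_le hφ fun ε hε => ?_, hwφ⟩
  obtain ⟨h₀, hh₀, hsq'⟩ := eventually_toBoundary.1 (hsq (ε / 25) (by linarith))
  refine ⟨h₀, hh₀, fun c ℓ hℓ => ?_⟩
  have hn := hcircle c ⟨hℓ.1, hℓ.2.trans hh₀.2⟩
  set lam := ((1 - ℓ : ℝ) : ℂ) * (AddCircle.toCircle c : ℂ) with hlam
  have hℓ' : 1 - ‖lam‖ = ℓ := by rw [hn]; ring
  obtain ⟨a, ha⟩ := hsq' lam (by rw [hℓ']; exact hℓ)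
  have hle := arcMeasure_le_poissonMeasure (lam := lam) (c := c) (by linarith [hℓ.1])
    (by rw [hn])
  rw [hℓ'] at hle
  refine ⟨a, (lintegral_mono' hle le_rfl).trans ?_⟩
  rw [lintegral_smul_measure, smul_eq_mul]
  refine (mul_le_mul_right ha _).trans (le_of_eq ?_)
  rw [← ENNReal.ofReal_ofNat, ← ENNReal.ofReal_mul (by norm_num)]
  congr 1
  ring

theorem lemmal2p1 (w : UnitAddCircle → ℝ≥0∞) (hw : AEMeasurable w volume) :
    List.TFAE [
      limsup (fun I : UnitAddCircle × ℝ =>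
        arcAverage w I.1 I.2 * arcAverage (fun θ => (w θ)⁻¹) I.1 I.2) arcsShrinking = 1,
      limsup (fun lam : ℂ =>
        harmonicExtension w lam * harmonicExtension (fun θ => (w θ)⁻¹) lam) toBoundary = 1,
      ∃ φ : UnitAddCircle → ℝ, IsVMO φ ∧
        ∀ᵐ θ : UnitAddCircle, w θ = ENNReal.ofReal (Real.exp (φ θ))] := by
  simp_rw [arcAverage_eq, ← lintegral_poissonMeasure]
  tfae_have 1 → 3 := exists_isVMO_of_limsup_arcMeasure hw
  tfae_have 2 → 3 := exists_isVMO_of_limsup_poissonMeasure hw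
  tfae_have 3 → 1 := fun ⟨_, hφ, hwφ⟩ =>
    limsup_means_eq_one_of_exp hφ.1.1.aemeasurable hwφ eventually_arcMeasure
      fun _ => hφ.eventually_lintegral_exp_arcMeasure_le
  tfae_have 3 → 2 := fun ⟨_, hφ, hwφ⟩ =>
    limsup_means_eq_one_of_exp hφ.1.1.aemeasurable hwφ eventually_poissonMeasure
      fun _ => hφ.eventually_lintegral_exp_poissonMeasure_le
  tfae_finish
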